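/- A Nevanlinna function is a holomorphic function $M$ on $\mathbb C^+$ with $\operatorname{Im}M\ge 0$. The class $\mathbf N_1$ consists of the meromorphic functions $Q$ on $\mathbb C^+$ whose kernel $\frac{Q(z)-\overline{Q(w)}}{z-\bar w}$ has precisely one negative square. Such a $Q$ factors uniquely as $Q=RM$ with $M$ a Nevanlinna function and $R(z)$ of one of the forms $\frac{(z-\alpha)(z-\bar\alpha)}{(z-\beta)(z-\bar\beta)}$, $(z-\alpha)(z-\bar\alpha)$ (put $\beta=\infty$), $\frac1{(z-\beta)(z-\bar\beta)}$ (put $\alpha=\infty$), where $\alpha\neq\beta$ and the finite ones among them lie in $\mathbb C^+\cup\mathbb R$; the point $\alpha$ is called the generalized zero of nonpositive type (GZNT) of $Q$. For $Q\in\mathbf N_1$ and $\tau\in\mathbb R$ the function $Q_\tau=\frac{Q-\tau}{1+\tau Q}$ is again in $\mathbf N_1$; let $\alpha(\tau)$ denote its GZNT. Below, $\arg$ is the principal argument, with values in $(-\pi,\pi]$, and a function on a real interval is called holomorphic if near each point of the interval it is given by a convergent power series with complex coefficients. **Theorem.** Let $Q\in\mathbf N_1$ and let $z_0,\tau_0\in\mathbb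 R$ with $\alpha(\tau_0)=z_0$. Assume that $Q$ extends from $\mathbb C^+$ to a holomorphic function $\widetilde Q$ on an open neighborhood $\Omega$ of $z_0$ in $\mathbb C$, that is, $\widetilde Q=Q$ on $\Omega\cap\mathbb C^+$ (no symmetry of $\widetilde Q$ with respect to $\mathbb R$ is assumed). Then there is $\varepsilon>0$ such that $\alpha(\tau)\in\mathbb C$ for $|\tau-\tau_0|<\varepsilon$, $\alpha(\tau)\ne z_0$ for $0<|\tau-\tau_0|<\varepsilon$, $\alpha(\tau)\to z_0$ as $\tau\to\tau_0$, and precisely one of the following cases occurs: (1) $\widetilde Q'(z_0)<0$ (in particular it is real). Then $\alpha$ is holomorphic on $(\tau_0-\varepsilon,\tau_0+\varepsilon)$ and $$\lim_{\tau\uparrow\tau_0}\arg(\alpha(\tau)-z_0)=0,\qquad \lim_{\tau\downarrow\tau_0}\arg(\alpha(\tau)-z_0)=\pi .$$ (2) $\widetilde Q'(z_0)=0$ and $\widetilde Q''(z_0)\ne0$. Then $\operatorname{Im}\widetilde Q''(z_0)\ge0$, $\alpha$ is holomorphic on each of the intervals $(\tau_0-\varepsilon,\tau_0)$ and $(\tau_0,\tau_0+\varepsilon)$,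 and, with $\theta_0=\arg\widetilde Q''(z_0)\in[0,\pi]$, $$\lim_{\tau\downarrow\tau_0}\arg(\alpha(\tau)-z_0)=\frac{2\pi-\theta_0}2,\qquad \lim_{\tau\uparrow\tau_0}\arg(\alpha(\tau)-z_0)=\frac{\pi-\theta_0}2 .$$ (3) $\widetilde Q'(z_0)=\widetilde Q''(z_0)=0$ and $\widetilde Q'''(z_0)\neq0$. Then $\alpha$ is holomorphic on each of the intervals $(\tau_0-\varepsilon,\tau_0)$ and $(\tau_0,\tau_0+\varepsilon)$, and $$\lim_{\tau\uparrow\tau_0}\arg(\alpha(\tau)-z_0)=\frac\pi3,\qquad \lim_{\tau\downarrow\tau_0}\arg(\alpha(\tau)-z_0)=\frac{2\pi}3 .$$ -/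

import Mathlib

open Filter Topology Matrix ComplexConjugate
open UpperHalfPlane (upperHalfPlaneSet)

/-- The Nevanlinna kernel `(Q z - conj (Q w)) / (z - conj w)` of a function `Q`. -/
noncomputable def nevanlinnaKernel (Q : ℂ → ℂ) (z w : ℂ) : ℂ :=
  (Q z - conj (Q w)) / (z - conj w)

/-- The matrix of the Nevanlinna kernel at the points `z 0, …, z (n - 1)`. -/
noncomputable def kernelMatrix (Q : ℂ → ℂ) {n : ℕ} (z : Fin n → ℂ) : Matrix (Fin n) (Fin n) ℂ :=
  Matrix.of fun i j => nevanlinnaKernel Q (z i) (z j)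

theorem kernelMatrix_isHermitian (Q : ℂ → ℂ) {n : ℕ} (z : Fin n → ℂ) :
    (kernelMatrix Q z).IsHermitian := by
  ext i j
  simp only [kernelMatrix, nevanlinnaKernel, Matrix.conjTranspose_apply, Matrix.of_apply,
    RCLike.star_def, map_div₀, map_sub, Complex.conj_conj]
  rw [← neg_sub (Q (z i)), ← neg_sub (z i), neg_div_neg_eq]

/-- The number of negative eigenvalues, counted with multiplicity, of the Hermitian matrix of the
Nevanlinna kernel at the points `z 0, …, z (n - 1)`. -/
noncomputable def negativeSquares (Q : ℂ → ℂ) {n : ℕ} (z : Fin n → ℂ) : ℕ :=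
  Nat.card {i : Fin n // (kernelMatrix_isHermitian Q z).eigenvalues i < 0}

/-- The points of the open upper half-plane at which `Q` is holomorphic. -/
def holomorphyDomain (Q : ℂ → ℂ) : Set ℂ :=
  {z | z ∈ upperHalfPlaneSet ∧ AnalyticAt ℂ Q z}

/-- The class `N₁`: `Q` is meromorphic in the open upper half-plane and its Nevanlinna kernel has
precisely one negative square, that is, at any finite family of points of holomorphy the Hermitian
kernel matrix has at most one negative eigenvalue, and for some family it has exactly one. -/
structure IsN1 (Q : ℂ → ℂ) : Prop where
  meromorphic : MeromorphicOn Q upperHalfPlaneSet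
  at_most_one : ∀ (n : ℕ) (z : Fin n → ℂ), (∀ i, z i ∈ holomorphyDomain Q) →
    negativeSquares Q z ≤ 1
  exactly_one : ∃ (n : ℕ) (z : Fin n → ℂ), (∀ i, z i ∈ holomorphyDomain Q) ∧
    negativeSquares Q z = 1

/-- Nevanlinna functions, on the open upper half-plane: holomorphic, with values in the closed
upper half-plane (real constants are allowed). -/
structure IsNevanlinna (M : ℂ → ℂ) : Prop where
  holomorphic : DifferentiableOn ℂ M upperHalfPlaneSet
  im_nonneg : ∀ z ∈ upperHalfPlaneSet, 0 ≤ (M z).im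

/-- The closed upper half-plane, together with the point `∞`, in the Riemann sphere. -/
def closedUpperHalfSphere : Set (OnePoint ℂ) :=
  {p | ∀ a : ℂ, p = (a : OnePoint ℂ) → 0 ≤ a.im}

/-- `(z - a) (z - conj a)` for finite `a`, and `1` for `a = ∞`. -/
noncomputable def quadraticFactor (p : OnePoint ℂ) (z : ℂ) : ℂ :=
  p.elim 1 fun a => (z - a) * (z - conj a)

/-- `α` is a generalized zero of nonpositive type of `Q`: as meromorphic functions on the upper
half-plane, `Q = R * M` where `M` is a Nevanlinna function and `R` is
`(z - α) (z - conj α) / ((z - β) (z - conj β))`, a factor with an infinite `α` or `β` being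
replaced by `1`; here `α ≠ β` are in the closed upper half-plane or `∞`. -/
def IsGZNT (Q : ℂ → ℂ) (α : OnePoint ℂ) : Prop :=
  α ∈ closedUpperHalfSphere ∧ ∃ β ∈ closedUpperHalfSphere, α ≠ β ∧
    ∃ M : ℂ → ℂ, IsNevanlinna M ∧
      Q =ᶠ[codiscreteWithin upperHalfPlaneSet]
        fun z => quadraticFactor α z / quadraticFactor β z * M z

/-- The fractional linear transform `Q_τ = (Q - τ) / (1 + τ Q)`, for real `τ`. -/
noncomputable def moebiusTransform (Q : ℂ → ℂ) (τ : ℝ) (z : ℂ) : ℂ :=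
  (Q z - τ) / (1 + τ * Q z)

/-!
The class `N₁` enters only through the fact that `Q` is not a real constant
(`IsN1.not_eventually_eq_real`); everything else follows from the factorizations
`Q_τ = R_τ * M_τ` behind the generalized zeros `α τ`, with `M_τ` a Nevanlinna function.

A Nevanlinna function that vanishes somewhere in the open upper half-plane is identically zero, and
one that is meromorphic at a real point has there order `-1`, `0` or `1`, with leading coefficient
negative, in the closed upper half-plane, or positive, respectively (`order_and_sign_of_im_nonneg`).
This has three consequences for the extension `Qt`.

* A solution `z` of `Qt z = τ` in the open upper half-plane is equal to `α τ`, and so is a real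
  solution with `Re Qt' z < 0` (`IsExtensionGZNT.eq_of_im_pos`, `IsExtensionGZNT.eq_of_real`).
* At `z₀ = α τ₀`, one has `Qt z = τ₀ + (z - z₀) ^ n * f z` with `n = 1` and `f z₀ < 0`, or `n = 2`
  and `0 ≤ Im (f z₀)`, or `n = 3` and `0 < f z₀` (`IsExtensionGZNT.order_at`). These are the three
  cases of the theorem.
* `0 ≤ Im (Qt x)` for real `x` near `z₀` (`IsExtensionGZNT.eventually_im_nonneg`).

The solutions of `Qt z = τ` near `z₀` are `z = ψ (s ω)`, where `ψ` is analytic with `ψ 0 = z₀` and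
`ψ' 0 = 1`, `s = |τ - τ₀| ^ (1 / n)`, and `f z₀ * ω ^ n` is the sign of `τ - τ₀`. In each case and
on each side of `τ₀` one of the roots `ω` lies in the open upper half-plane, or is real with
`Qt' < 0` to leading order along `ω`. If `ω` is not real, `ψ (s ω)` lies in the open upper
half-plane for small `s`. If `ω` is real, `ψ (s ω)` may be real or not, but it is not in the lower
half-plane: as `Re Qt' < 0` nearby, `Im Qt` would then be negative at the real point above it.
Either way `ψ (s ω) = α τ` (`eventually_eq_branch`), and hence `arg (α τ - z₀)` tends to `arg ω`. Uniqueness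
of generalized zeros in general is not needed.
-/

theorem isOpen_upperHalfPlaneSet : IsOpen upperHalfPlaneSet :=
  UpperHalfPlane.isOpen_upperHalfPlaneSet

theorem isConnected_upperHalfPlaneSet : IsConnected upperHalfPlaneSet :=
  ⟨⟨Complex.I, by simp [upperHalfPlaneSet]⟩, (convex_halfSpace_im_gt 0).isPreconnected⟩

/-! ### Functions in the class `N₁` are not real constants -/

/-- The kernel of a real constant vanishes, so it has no negative square; by the identity theorem
it is enough to know that `Q` is constant near one point. -/
theorem IsN1.not_eventually_eq_real {Q : ℂ → ℂ} (hQ : IsN1 Q) {z₁ : ℂ}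
    (hz₁ : z₁ ∈ upperHalfPlaneSet) (c : ℝ) : ¬ ∀ᶠ z in 𝓝[≠] z₁, Q z = c := by
  intro hc
  have hmer : MeromorphicOn (fun z => Q z - c) upperHalfPlaneSet :=
    fun z hz => (hQ.meromorphic z hz).sub (MeromorphicAt.const _ _)
  have htop : ∀ z ∈ upperHalfPlaneSet, ∀ᶠ w in 𝓝[≠] z, Q w = c := by
    intro z hz
    by_contra hcon
    have h1 : meromorphicOrderAt (fun z => Q z - c) z ≠ ⊤ := by
      rw [Ne, meromorphicOrderAt_eq_top_iff]
      simpa only [sub_eq_zero] using hcon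
    have h2 := hmer.meromorphicOrderAt_ne_top_of_isPreconnected
      isConnected_upperHalfPlaneSet.isPreconnected hz hz₁ h1
    rw [Ne, meromorphicOrderAt_eq_top_iff] at h2
    exact h2 (by simpa only [sub_eq_zero] using hc)
  have hval : ∀ z ∈ holomorphyDomain Q, Q z = c := by
    rintro z ⟨hz, hQz⟩
    have := (hQz.continuousAt.eventuallyEq_nhds_iff_eventuallyEq_nhdsNE
      (continuousAt_const (y := (c : ℂ)))).1 (htop z hz)
    exact this.self_of_nhds
  obtain ⟨n, z, hz, hneg⟩ := hQ.exactly_one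
  have hzero : kernelMatrix Q z = 0 := by
    ext i j
    simp [kernelMatrix, nevanlinnaKernel, hval _ (hz i), hval _ (hz j)]
  have hev : (kernelMatrix_isHermitian Q z).eigenvalues = 0 :=
    (kernelMatrix_isHermitian Q z).eigenvalues_eq_zero_iff.2 hzero
  simp [negativeSquares, hev] at hneg

/-! ### Nevanlinna functions -/

theorem IsNevanlinna.eq_zero_of_apply_eq_zero {M : ℂ → ℂ} (hM : IsNevanlinna M) {z : ℂ}
    (hz : z ∈ upperHalfPlaneSet) (h : M z = 0) : ∀ w ∈ upperHalfPlaneSet, M w = 0 := by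
  have han : AnalyticOnNhd ℂ M upperHalfPlaneSet :=
    hM.holomorphic.analyticOnNhd isOpen_upperHalfPlaneSet
  rcases han.is_constant_or_isOpen isConnected_upperHalfPlaneSet.isPreconnected with ⟨w, hw⟩ | hop
  · intro u hu
    rw [hw u hu, ← hw z hz, h]
  · exfalso
    have ho := hop _ subset_rfl isOpen_upperHalfPlaneSet
    have h0 : (0 : ℂ) ∈ M '' upperHalfPlaneSet := ⟨z, hz, h⟩
    obtain ⟨r, hr, hball⟩ := Metric.isOpen_iff.1 ho 0 h0
    have : (-(r / 2 : ℝ) * Complex.I : ℂ) ∈ Metric.ball (0 : ℂ) r := by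
      simp [abs_of_pos hr]; linarith
    obtain ⟨u, hu, hMu⟩ := hball this
    have := hM.im_nonneg u hu
    rw [hMu] at this
    simp at this
    linarith

/-- If `(z - x) ^ n * g z` has nonnegative imaginary part in the upper half-plane near the real
point `x`, so have its radial limits `exp (i n θ) * g x` after rescaling. -/
theorem im_exp_mul_nonneg {x : ℝ} {n : ℤ} {g : ℂ → ℂ} (hg : ContinuousAt g x)
    (h : ∀ᶠ z in 𝓝[upperHalfPlaneSet] (x : ℂ), 0 ≤ ((z - x) ^ n * g z).im)
    {θ : ℝ} (hθ : θ ∈ Set.Icc 0 Real.pi) :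
    0 ≤ (Complex.exp (((n : ℝ) * θ : ℝ) * Complex.I) * g x).im := by
  have hclosed : IsClosed {θ : ℝ | 0 ≤ (Complex.exp (((n : ℝ) * θ : ℝ) * Complex.I) * g x).im} :=
    isClosed_le continuous_const (by fun_prop)
  have hsub : Set.Ioo 0 Real.pi ⊆
      {θ : ℝ | 0 ≤ (Complex.exp (((n : ℝ) * θ : ℝ) * Complex.I) * g x).im} := by
    intro θ hθ
    set e : ℂ := Complex.exp (θ * Complex.I) with he
    have hcurve : Tendsto (fun t : ℝ => (x : ℂ) + t * e) (𝓝[>] 0) (𝓝 (x : ℂ)) := by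
      have : Continuous (fun t : ℝ => (x : ℂ) + t * e) := by fun_prop
      simpa using (this.tendsto 0).mono_left nhdsWithin_le_nhds
    have hcurve' : Tendsto (fun t : ℝ => (x : ℂ) + t * e) (𝓝[>] 0)
        (𝓝[upperHalfPlaneSet] (x : ℂ)) := by
      refine tendsto_nhdsWithin_iff.2 ⟨hcurve, ?_⟩
      filter_upwards [self_mem_nhdsWithin] with t ht
      have : 0 < t * Real.sin θ := mul_pos ht (Real.sin_pos_of_mem_Ioo hθ)
      simpa [upperHalfPlaneSet, he, Complex.exp_ofReal_mul_I_im] using this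
    have hlim : Tendsto (fun t : ℝ => (e ^ n * g ((x : ℂ) + t * e)).im) (𝓝[>] 0)
        (𝓝 (e ^ n * g x).im) :=
      (Complex.continuous_im.tendsto _).comp (tendsto_const_nhds.mul (hg.tendsto.comp hcurve))
    have hpos : ∀ᶠ t : ℝ in 𝓝[>] 0, 0 ≤ (e ^ n * g ((x : ℂ) + t * e)).im := by
      filter_upwards [hcurve'.eventually h, self_mem_nhdsWithin] with t ht htp
      have htp : 0 < t := htp
      have h1 : ((x : ℂ) + t * e - x) ^ n * g (x + t * e)
          = ((t ^ n : ℝ) : ℂ) * (e ^ n * g (x + t * e)) := by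
        rw [add_sub_cancel_left, mul_zpow]; push_cast; ring
      rw [h1, Complex.im_ofReal_mul] at ht
      exact nonneg_of_mul_nonneg_right ht (zpow_pos htp n)
    have := ge_of_tendsto hlim hpos
    have hen : e ^ n = Complex.exp (((n : ℝ) * θ : ℝ) * Complex.I) := by
      rw [he, ← Complex.exp_int_mul]; push_cast; ring_nf
    rw [Set.mem_ofPred_eq, ← hen]
    exact this
  have := hclosed.closure_subset_iff.2 hsub
  rw [closure_Ioo Real.pi_pos.ne] at this
  exact this hθ

/-- A function with nonnegative imaginary part in the upper half-plane and of finite order at a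
real point has there a simple pole, a regular nonzero value, or a simple zero. -/
theorem order_and_sign_of_im_nonneg {x : ℝ} {n : ℤ} {g : ℂ → ℂ} (hg : ContinuousAt g x)
    (hgx : g x ≠ 0)
    (h : ∀ᶠ z in 𝓝[upperHalfPlaneSet] (x : ℂ), 0 ≤ ((z - x) ^ n * g z).im) :
    (n = -1 ∧ (g x).im = 0 ∧ (g x).re < 0) ∨ (n = 0 ∧ 0 ≤ (g x).im) ∨
      (n = 1 ∧ (g x).im = 0 ∧ 0 < (g x).re) := by
  have key : ∀ θ ∈ Set.Icc 0 Real.pi,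
      0 ≤ Real.cos (n * θ) * (g x).im + Real.sin (n * θ) * (g x).re := by
    intro θ hθ
    have := im_exp_mul_nonneg hg h hθ
    rwa [Complex.mul_im, Complex.exp_ofReal_mul_I_re, Complex.exp_ofReal_mul_I_im] at this
  have hpi := Real.pi_pos
  have k0 := key 0 ⟨le_rfl, hpi.le⟩
  simp only [mul_zero, Real.cos_zero, Real.sin_zero, one_mul, zero_mul, add_zero] at k0
  by_cases hn0 : n = 0
  · exact Or.inr (Or.inl ⟨hn0, k0⟩)
  -- the points `π / |n|` and `π / (2 |n|)` of `[0, π]` give the signs of both parts of `g x`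
  obtain ⟨m, ε, hm, hε, hnm⟩ : ∃ m ε : ℝ, 1 ≤ m ∧ (ε = 1 ∨ ε = -1) ∧ (n : ℝ) = ε * m := by
    rcases lt_or_gt_of_ne hn0 with hlt | hgt
    · refine ⟨-n, -1, ?_, Or.inr rfl, by ring⟩
      have : n ≤ -1 := by omega
      have : (n : ℝ) ≤ -1 := by exact_mod_cast this
      linarith
    · exact ⟨n, 1, by exact_mod_cast (by omega : (1 : ℤ) ≤ n), Or.inl rfl, by ring⟩
  have hm0 : 0 < m := by linarith
  have hcos : ∀ t : ℝ, Real.cos (ε * t) = Real.cos t := by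
    intro t; rcases hε with rfl | rfl <;> simp
  have hsin : ∀ t : ℝ, Real.sin (ε * t) = ε * Real.sin t := by
    intro t; rcases hε with rfl | rfl <;> simp
  have key' : ∀ t ∈ Set.Icc 0 (m * Real.pi),
      0 ≤ Real.cos t * (g x).im + ε * Real.sin t * (g x).re := by
    intro t ht
    have := key (t / m) ⟨div_nonneg ht.1 hm0.le, by rw [div_le_iff₀ hm0]; linarith [ht.2]⟩
    rwa [hnm, mul_assoc, mul_div_cancel₀ _ hm0.ne', hcos, hsin] at this
  have k1 := key' Real.pi ⟨hpi.le, by nlinarith⟩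
  have k2 := key' (Real.pi / 2) ⟨by linarith, by nlinarith⟩
  simp only [Real.cos_pi, Real.sin_pi, Real.cos_pi_div_two, Real.sin_pi_div_two] at k1 k2
  have him : (g x).im = 0 := by linarith
  have hre : (g x).re ≠ 0 := fun hre => hgx (Complex.ext hre him)
  have hm1 : m < 2 := by
    by_contra hcon
    have k3 := key' (Real.pi / 2 + Real.pi) ⟨by linarith, by nlinarith⟩
    rw [Real.cos_add_pi, Real.sin_add_pi, Real.cos_pi_div_two, Real.sin_pi_div_two] at k3
    rcases hε with rfl | rfl <;> exact hre (by linarith)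
  rcases hε with rfl | rfl
  · refine Or.inr (Or.inr ⟨?_, him, lt_of_le_of_ne (by linarith) hre.symm⟩)
    have h1 : (n : ℝ) < 2 := by linarith
    have h2 : (1 : ℝ) ≤ n := by linarith
    have h1' : n < 2 := by exact_mod_cast h1
    have h2' : 1 ≤ n := by exact_mod_cast h2
    omega
  · refine Or.inl ⟨?_, him, lt_of_le_of_ne (by linarith) hre⟩
    have h1 : (-2 : ℝ) < n := by linarith
    have h2 : (n : ℝ) ≤ -1 := by linarith
    have h1' : -2 < n := by exact_mod_cast h1
    have h2' : n ≤ -1 := by exact_mod_cast h2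
    omega

/-! ### The quadratic factors -/

theorem differentiable_quadraticFactor (p : OnePoint ℂ) :
    Differentiable ℂ (quadraticFactor p) := by
  induction p using OnePoint.rec with
  | infty => exact differentiable_const (1 : ℂ)
  | coe a =>
    change Differentiable ℂ fun z => (z - a) * (z - conj a)
    fun_prop

theorem quadraticFactor_coe (a z : ℂ) : quadraticFactor a z = (z - a) * (z - conj a) := rfl

theorem quadraticFactor_ofReal_pos {p : OnePoint ℂ} {x : ℝ} (h : p ≠ ((x : ℂ) : OnePoint ℂ)) :
    ∃ r : ℝ, 0 < r ∧ quadraticFactor p x = r := by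
  induction p using OnePoint.rec with
  | infty => exact ⟨1, one_pos, by simp [quadraticFactor]⟩
  | coe a =>
    have ha : (x : ℂ) - a ≠ 0 := fun h' => h (by rw [sub_eq_zero.1 h'])
    refine ⟨Complex.normSq (x - a), Complex.normSq_pos.2 ha, ?_⟩
    rw [quadraticFactor_coe, ← Complex.mul_conj]
    simp

theorem eventually_quadraticFactor_ne_zero (p : OnePoint ℂ) (z : ℂ) :
    ∀ᶠ w in 𝓝[≠] z, quadraticFactor p w ≠ 0 := by
  induction p using OnePoint.rec with
  | infty => exact Eventually.of_forall fun w => by simp [quadraticFactor]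
  | coe a =>
    have h (b : ℂ) : ∀ᶠ w in 𝓝[≠] z, w ≠ b := by
      by_cases hb : z = b
      · rw [← hb]; exact self_mem_nhdsWithin
      · exact eventually_nhdsWithin_of_eventually_nhds (isOpen_ne.mem_nhds hb)
    filter_upwards [h a, h (conj a)] with w h1 h2
    exact mul_ne_zero (sub_ne_zero.2 h1) (sub_ne_zero.2 h2)

/-! ### Generalized zeros of nonpositive type seen on the domain of the extension -/

/-- The factorization behind `IsGZNT` for the transform of `Q` with parameter `τ`, written without
denominators on the part of `Ω` in the upper half-plane, in terms of an extension `Qt` of `Q`.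
Points with `1 + τ * Qt z = 0`, where the transform has a pole, are left out. -/
def IsExtensionGZNT (Qt : ℂ → ℂ) (Ω : Set ℂ) (τ : ℝ) (p : OnePoint ℂ) : Prop :=
  p ∈ closedUpperHalfSphere ∧ ∃ β ∈ closedUpperHalfSphere, p ≠ β ∧
    ∃ M : ℂ → ℂ, IsNevanlinna M ∧ ∀ z ∈ Ω ∩ upperHalfPlaneSet, 1 + τ * Qt z ≠ 0 →
      (Qt z - τ) * quadraticFactor β z = quadraticFactor p z * M z * (1 + τ * Qt z)

theorem eventually_nhdsNE_of_codiscreteWithin {V : Set ℂ} (hV : IsOpen V) {P : ℂ → Prop}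
    (h : ∀ᶠ z in codiscreteWithin V, P z) {z : ℂ} (hz : z ∈ V) : ∀ᶠ w in 𝓝[≠] z, P w := by
  have h1 := mem_codiscreteWithin_iff_forall_mem_nhdsNE.1 h z hz
  filter_upwards [h1, mem_nhdsWithin_of_mem_nhds (hV.mem_nhds hz)] with w hw hwV
  exact hw.resolve_right fun h => h hwV

theorem IsGZNT.isExtensionGZNT {Q Qt : ℂ → ℂ} {Ω : Set ℂ} {τ : ℝ} {p : OnePoint ℂ}
    (h : IsGZNT (moebiusTransform Q τ) p) (hΩ : IsOpen Ω) (hQt : DifferentiableOn ℂ Qt Ω)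
    (hext : Q =ᶠ[codiscreteWithin (Ω ∩ upperHalfPlaneSet)] Qt) : IsExtensionGZNT Qt Ω τ p := by
  obtain ⟨hp, β, hβ, hpβ, M, hM, hfac⟩ := h
  refine ⟨hp, β, hβ, hpβ, M, hM, fun z hz h1 => ?_⟩
  have hQz : ContinuousAt Qt z := (hQt.differentiableAt (hΩ.mem_nhds hz.1)).continuousAt
  have hMz : ContinuousAt M z :=
    (hM.holomorphic.differentiableAt (isOpen_upperHalfPlaneSet.mem_nhds hz.2)).continuousAt
  have hβz := (differentiable_quadraticFactor β).continuous.continuousAt (x := z)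
  have hpz := (differentiable_quadraticFactor p).continuous.continuousAt (x := z)
  have hev : ∀ᶠ w in 𝓝[≠] z, (Qt w - τ) * quadraticFactor β w
      = quadraticFactor p w * M w * (1 + τ * Qt w) := by
    have hden : ContinuousAt (fun w => 1 + τ * Qt w) z := by fun_prop
    filter_upwards [eventually_nhdsNE_of_codiscreteWithin isOpen_upperHalfPlaneSet hfac hz.2,
      eventually_nhdsNE_of_codiscreteWithin (hΩ.inter isOpen_upperHalfPlaneSet) hext hz,
      eventually_quadraticFactor_ne_zero β z,
      mem_nhdsWithin_of_mem_nhds (hden.eventually_ne h1)] with w hw hQw hβw hdw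
    rw [moebiusTransform, hQw] at hw
    rw [div_mul_eq_mul_div, div_eq_div_iff hdw hβw] at hw
    exact hw
  exact ((ContinuousAt.eventuallyEq_nhds_iff_eventuallyEq_nhdsNE (by fun_prop)
    (by fun_prop)).1 hev).self_of_nhds

/-- A zero of `Qt - τ` in the upper half-plane is the generalized zero, because a nonzero
Nevanlinna function has no zeros there. -/
theorem IsExtensionGZNT.eq_of_im_pos {Qt : ℂ → ℂ} {Ω : Set ℂ} {τ : ℝ} {p : OnePoint ℂ}
    (h : IsExtensionGZNT Qt Ω τ p) (hΩ : IsOpen Ω) (hQt : DifferentiableOn ℂ Qt Ω) {z : ℂ}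
    (hz : z ∈ Ω) (hzim : 0 < z.im) (hnc : ¬ ∀ᶠ w in 𝓝[≠] z, Qt w = τ) (hval : Qt z = τ) :
    p = z := by
  obtain ⟨hp, β, hβ, hpβ, M, hM, hfac⟩ := h
  have hτ : (1 + τ * τ : ℂ) ≠ 0 := by
    have : (1 + τ * τ : ℝ) ≠ 0 := by nlinarith [mul_self_nonneg τ]
    exact_mod_cast this
  have h0 := hfac z ⟨hz, hzim⟩ (by rwa [hval])
  rw [hval, sub_self, zero_mul] at h0
  have h0 : quadraticFactor p z * M z = 0 := by
    simpa [hτ] using h0.symm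
  rcases mul_eq_zero.1 h0 with h0 | h0
  · induction p using OnePoint.rec with
    | infty => simp [quadraticFactor] at h0
    | coe a =>
      rw [quadraticFactor_coe, mul_eq_zero, sub_eq_zero, sub_eq_zero] at h0
      rcases h0 with h0 | h0
      · rw [h0]
      · have ha : 0 ≤ a.im := hp a rfl
        rw [h0, Complex.conj_im] at hzim
        linarith
  · exfalso
    have hM0 := hM.eq_zero_of_apply_eq_zero hzim h0
    apply hnc
    have hQz : ContinuousAt Qt z := (hQt.differentiableAt (hΩ.mem_nhds hz)).continuousAt
    have hden : ContinuousAt (fun w => 1 + τ * Qt w) z := by fun_prop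
    filter_upwards [mem_nhdsWithin_of_mem_nhds (hden.eventually_ne (by rwa [hval])),
      mem_nhdsWithin_of_mem_nhds (hΩ.mem_nhds hz),
      mem_nhdsWithin_of_mem_nhds (isOpen_upperHalfPlaneSet.mem_nhds hzim),
      eventually_quadraticFactor_ne_zero β z] with w hdw hwΩ hwU hβw
    have := hfac w ⟨hwΩ, hwU⟩ hdw
    rw [hM0 w hwU, mul_zero, zero_mul] at this
    exact sub_eq_zero.1 ((mul_eq_zero.1 this).resolve_right hβw)

theorem eventually_nhdsWithin_upperHalfPlaneSet_ne (x : ℝ) :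
    ∀ᶠ z : ℂ in 𝓝[upperHalfPlaneSet] (x : ℂ), z - x ≠ 0 := by
  filter_upwards [self_mem_nhdsWithin] with z hz h
  rw [sub_eq_zero.1 h] at hz
  simp at hz

/-- A real zero of `Qt - τ` at which the derivative has negative real part is the generalized
zero: otherwise the Nevanlinna factor would have there a simple zero with the wrong sign of the
derivative, or a triple zero. -/
theorem IsExtensionGZNT.eq_of_real {Qt : ℂ → ℂ} {Ω : Set ℂ} {τ : ℝ} {p : OnePoint ℂ}
    (h : IsExtensionGZNT Qt Ω τ p) (hΩ : IsOpen Ω) (hQt : DifferentiableOn ℂ Qt Ω) {x : ℝ}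
    (hx : (x : ℂ) ∈ Ω) (hval : Qt x = τ) (hder : (deriv Qt x).re < 0) :
    p = (x : ℂ) := by
  by_contra hpx
  obtain ⟨hp, β, hβ, hpβ, M, hM, hfac⟩ := h
  have hdiff := hQt.differentiableAt (hΩ.mem_nhds hx)
  have hQx : ContinuousAt Qt x := hdiff.continuousAt
  have hτ : 0 < 1 + τ * τ := by nlinarith [mul_self_nonneg τ]
  have hτ' : (1 + τ * τ : ℂ) ≠ 0 := by exact_mod_cast hτ.ne'
  obtain ⟨r, hr, hpr⟩ := quadraticFactor_ofReal_pos hpx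
  have hr' : (r : ℂ) ≠ 0 := by exact_mod_cast hr.ne'
  have hden : ContinuousAt (fun w => 1 + τ * Qt w) x := by fun_prop
  have hpc := (differentiable_quadraticFactor p).continuous.continuousAt (x := (x : ℂ))
  have hβc := (differentiable_quadraticFactor β).continuous.continuousAt (x := (x : ℂ))
  have hds : ContinuousAt (dslope Qt x) x := continuousAt_dslope_same.2 hdiff
  have hden0 : 1 + τ * Qt x ≠ 0 := by rwa [hval]
  have hp0 : quadraticFactor p x ≠ 0 := by rwa [hpr]
  have hM' : ∀ᶠ z in 𝓝[upperHalfPlaneSet] (x : ℂ), 0 ≤ (M z).im ∧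
      M z = (z - x) * dslope Qt x z * quadraticFactor β z
        / (quadraticFactor p z * (1 + τ * Qt z)) := by
    filter_upwards [self_mem_nhdsWithin, mem_nhdsWithin_of_mem_nhds (hΩ.mem_nhds hx),
      mem_nhdsWithin_of_mem_nhds (hden.eventually_ne hden0),
      mem_nhdsWithin_of_mem_nhds (hpc.eventually_ne hp0)] with z hzU hzΩ hdz hpz
    refine ⟨hM.im_nonneg z hzU, ?_⟩
    have h1 := hfac z ⟨hzΩ, hzU⟩ hdz
    have h2 : (z - x) * dslope Qt x z = Qt z - τ := by
      have := sub_smul_dslope Qt (x : ℂ) z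
      rwa [smul_eq_mul, hval] at this
    rw [eq_div_iff (mul_ne_zero hpz hdz), h2, h1]
    ring
  have hqne : deriv Qt x ≠ 0 := fun h => by simp [h] at hder
  by_cases hβx : β = ((x : ℂ) : OnePoint ℂ)
  · -- the factor `quadraticFactor β z = (z - x) ^ 2` makes the order three
    have h3 := order_and_sign_of_im_nonneg (x := x) (n := 3)
      (g := fun z => dslope Qt x z / (quadraticFactor p z * (1 + τ * Qt z)))
      (hds.div (hpc.mul hden) (mul_ne_zero hp0 hden0))
      (by
        rw [dslope_same]
        exact div_ne_zero hqne (mul_ne_zero hp0 hden0))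
      (by
        filter_upwards [hM'] with z hz
        have : (z - x) ^ (3 : ℤ) * (dslope Qt x z / (quadraticFactor p z * (1 + τ * Qt z)))
            = M z := by
          rw [hz.2, hβx, quadraticFactor_coe, Complex.conj_ofReal]
          norm_cast
          ring
        rw [this]
        exact hz.1)
    omega
  · obtain ⟨r', hr'', hβr⟩ := quadraticFactor_ofReal_pos hβx
    have hβ0 : quadraticFactor β x ≠ 0 := by rw [hβr]; exact_mod_cast hr''.ne'
    have h3 := order_and_sign_of_im_nonneg (x := x) (n := 1)
      (g := fun z => dslope Qt x z * quadraticFactor β z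
        / (quadraticFactor p z * (1 + τ * Qt z)))
      ((hds.mul hβc).div (hpc.mul hden) (mul_ne_zero hp0 hden0))
      (by
        rw [dslope_same]
        exact div_ne_zero (mul_ne_zero hqne hβ0) (mul_ne_zero hp0 hden0))
      (by
        filter_upwards [hM'] with z hz
        have : (z - x) ^ (1 : ℤ) * (dslope Qt x z * quadraticFactor β z
            / (quadraticFactor p z * (1 + τ * Qt z))) = M z := by
          rw [hz.2, zpow_one]
          ring
        rw [this]
        exact hz.1)
    have h4 : dslope Qt x x * quadraticFactor β x / (quadraticFactor p x * (1 + τ * Qt x))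
        = deriv Qt x * ((r' / (r * (1 + τ * τ)) : ℝ) : ℂ) := by
      rw [dslope_same, hβr, hpr, hval]
      push_cast
      ring
    simp only [h4, Complex.re_mul_ofReal] at h3
    have h5 : 0 < r' / (r * (1 + τ * τ)) := by positivity
    rcases h3 with ⟨h, _⟩ | ⟨h, _⟩ | ⟨_, _, h⟩
    · omega
    · omega
    · nlinarith

/-- At a real generalized zero `x` of the transform with parameter `τ`, the Nevanlinna
factor has order `-1`, `0` or `1`, hence `Qt - τ` has order `1`, `2` or `3`, with a sign condition on the leading coefficient. -/
theorem IsExtensionGZNT.order_at {Qt : ℂ → ℂ} {Ω : Set ℂ} {τ x : ℝ}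
    (h : IsExtensionGZNT Qt Ω τ (x : ℂ)) (hΩ : IsOpen Ω) (hQt : DifferentiableOn ℂ Qt Ω)
    (hx : (x : ℂ) ∈ Ω) (hnc : ∀ c : ℝ, ¬ ∀ᶠ w in 𝓝 (x : ℂ), Qt w = c) :
    ∃ (n : ℕ) (f : ℂ → ℂ), AnalyticAt ℂ f x ∧ f x ≠ 0 ∧
      (∀ᶠ z in 𝓝 (x : ℂ), Qt z = τ + (z - x) ^ n * f z) ∧
      ((n = 1 ∧ (f x).im = 0 ∧ (f x).re < 0) ∨ (n = 2 ∧ 0 ≤ (f x).im) ∨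
        (n = 3 ∧ (f x).im = 0 ∧ 0 < (f x).re)) := by
  obtain ⟨-, β, hβ, hpβ, M, hM, hfac⟩ := h
  have han : AnalyticAt ℂ Qt x := hQt.analyticAt (hΩ.mem_nhds hx)
  obtain ⟨n, f, hf, hf0, hnf⟩ := (AnalyticAt.exists_eventuallyEq_pow_smul_nonzero_iff
    (f := fun z => Qt z - τ) (z₀ := (x : ℂ)) (by fun_prop)).2
    (by simpa only [sub_eq_zero] using hnc τ)
  obtain ⟨m, k, hk, hk0, hmk⟩ := (AnalyticAt.exists_eventuallyEq_pow_smul_nonzero_iff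
    (f := fun z => 1 + τ * Qt z) (z₀ := (x : ℂ)) (by fun_prop)).2 (by
      intro hcon
      have hτ : (τ : ℂ) ≠ 0 := by
        rintro h0
        have := hcon.self_of_nhds
        simp [h0] at this
      apply hnc (-1 / τ)
      filter_upwards [hcon] with z hz
      push_cast
      field_simp
      linear_combination hz)
  obtain ⟨r, hr, hβr⟩ := quadraticFactor_ofReal_pos hpβ.symm
  have hβ0 : quadraticFactor β x ≠ 0 := by rw [hβr]; exact_mod_cast hr.ne'
  have hβc := (differentiable_quadraticFactor β).continuous.continuousAt (x := (x : ℂ))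
  have hord := order_and_sign_of_im_nonneg (x := x) (n := n - m - 2)
    (g := fun z => f z * quadraticFactor β z / k z)
    ((hf.continuousAt.mul hβc).div hk.continuousAt hk0)
    (div_ne_zero (mul_ne_zero hf0 hβ0) hk0)
    (by
      filter_upwards [self_mem_nhdsWithin, mem_nhdsWithin_of_mem_nhds (hΩ.mem_nhds hx),
        eventually_nhdsWithin_upperHalfPlaneSet_ne x, mem_nhdsWithin_of_mem_nhds hnf,
        mem_nhdsWithin_of_mem_nhds hmk,
        mem_nhdsWithin_of_mem_nhds (hk.continuousAt.eventually_ne hk0)]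
        with z hzU hzΩ hzx hzn hzm hzk
      rw [smul_eq_mul] at hzn hzm
      have h1 := hfac z ⟨hzΩ, hzU⟩ (by
        rw [hzm]; exact mul_ne_zero (pow_ne_zero _ hzx) hzk)
      rw [hzn, hzm, quadraticFactor_coe, Complex.conj_ofReal] at h1
      have h2 : (z - x) ^ ((n : ℤ) - m - 2) * (f z * quadraticFactor β z / k z) = M z := by
        rw [zpow_sub₀ hzx, zpow_sub₀ hzx, zpow_natCast, zpow_natCast]
        norm_cast
        have := pow_ne_zero m hzx
        field_simp
        linear_combination h1
      rw [h2]
      exact hM.im_nonneg z hzU)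
  have hn0 : n ≠ 0 := by omega
  have hval : Qt x = τ := by
    have := hnf.self_of_nhds
    simpa [hn0, sub_eq_zero] using this
  have hτ : 0 < 1 + τ * τ := by nlinarith [mul_self_nonneg τ]
  have hτ' : (1 + τ * τ : ℂ) ≠ 0 := by exact_mod_cast hτ.ne'
  have hkx := hmk.self_of_nhds
  have hm0 : m = 0 := by
    by_contra hm
    rw [hval] at hkx
    simp [hm, hτ'] at hkx
  subst hm0
  have hkx' : k x = 1 + τ * τ := by simpa [hval] using hkx.symm
  have hlead : f x * quadraticFactor β x / k x = f x * ((r / (1 + τ * τ) : ℝ) : ℂ) := by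
    rw [hkx', hβr]; push_cast; ring
  have hq : 0 < r / (1 + τ * τ) := by positivity
  simp only [hlead, Complex.re_mul_ofReal, Complex.im_mul_ofReal, mul_eq_zero, hq.ne', or_false,
    mul_nonneg_iff_of_pos_right hq, mul_pos_iff_of_pos_right hq] at hord
  refine ⟨n, f, hf, hf0, ?_, ?_⟩
  · filter_upwards [hnf] with z hz
    rw [smul_eq_mul] at hz
    linear_combination hz
  · rcases hord with ⟨h1, h2, h3⟩ | ⟨h1, h2⟩ | ⟨h1, h2, h3⟩
    · exact Or.inl ⟨by omega, h2, by nlinarith⟩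
    · exact Or.inr (Or.inl ⟨by omega, h2⟩)
    · exact Or.inr (Or.inr ⟨by omega, h2, h3⟩)

/-- At real points near a real generalized zero `x`, other than `x`, the boundary values of the
Nevanlinna factor exist and have nonnegative imaginary part, and the quotient of the quadratic
factors is positive; a real fractional linear transform of determinant `1 + τ ^ 2` preserves the
sign of imaginary parts. -/
theorem IsExtensionGZNT.eventually_im_nonneg {Qt : ℂ → ℂ} {Ω : Set ℂ} {τ x : ℝ}
    (h : IsExtensionGZNT Qt Ω τ (x : ℂ)) (hΩ : IsOpen Ω) (hQt : DifferentiableOn ℂ Qt Ω)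
    (hx : (x : ℂ) ∈ Ω) (hval : Qt x = τ) : ∀ᶠ y : ℝ in 𝓝 x, 0 ≤ (Qt y).im := by
  obtain ⟨-, β, hβ, hpβ, M, hM, hfac⟩ := h
  have hQx : ContinuousAt Qt x := (hQt.differentiableAt (hΩ.mem_nhds hx)).continuousAt
  have hτ : 0 < 1 + τ * τ := by nlinarith [mul_self_nonneg τ]
  have hτ' : (1 + τ * τ : ℂ) ≠ 0 := by exact_mod_cast hτ.ne'
  have hden : ContinuousAt (fun w => 1 + τ * Qt w) x := by fun_prop
  have hβc : Continuous (quadraticFactor β) := (differentiable_quadraticFactor β).continuous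
  obtain ⟨r, hr, hβr⟩ := quadraticFactor_ofReal_pos hpβ.symm
  have hβ0 : quadraticFactor β x ≠ 0 := by rw [hβr]; exact_mod_cast hr.ne'
  have hof : Tendsto (fun y : ℝ => (y : ℂ)) (𝓝 x) (𝓝 (x : ℂ)) :=
    Complex.continuous_ofReal.tendsto x
  filter_upwards [hof.eventually (hden.eventually_ne (by rwa [hval])),
    hof.eventually (hΩ.mem_nhds hx), hof.eventually (hβc.continuousAt.eventually_ne hβ0)]
    with y hdy hyΩ hβy
  by_cases hyx : y = x
  · rw [hyx, hval]; simp
  have hyx' : (y : ℂ) - x ≠ 0 := by rw [← Complex.ofReal_sub]; exact_mod_cast sub_ne_zero.2 hyx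
  have hβy' : β ≠ ((y : ℂ) : OnePoint ℂ) := by
    rintro rfl
    simp [quadraticFactor_coe] at hβy
  obtain ⟨s, hs, hβs⟩ := quadraticFactor_ofReal_pos hβy'
  have hQy : ContinuousAt Qt y := (hQt.differentiableAt (hΩ.mem_nhds hyΩ)).continuousAt
  have hden' : ContinuousAt (fun w => 1 + τ * Qt w) y := by fun_prop
  have hsq : ContinuousAt (fun w : ℂ => w - x) y := by fun_prop
  have hM := im_exp_mul_nonneg (x := y) (n := 0) (θ := 0)
    (g := fun z => (Qt z - τ) * quadraticFactor β z / ((z - x) ^ 2 * (1 + τ * Qt z)))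
    (((hQy.sub continuousAt_const).mul hβc.continuousAt).div ((hsq.pow 2).mul hden')
      (mul_ne_zero (pow_ne_zero 2 hyx') hdy))
    (by
      filter_upwards [self_mem_nhdsWithin, mem_nhdsWithin_of_mem_nhds (hΩ.mem_nhds hyΩ),
        mem_nhdsWithin_of_mem_nhds (hsq.eventually_ne hyx'),
        mem_nhdsWithin_of_mem_nhds (hden'.eventually_ne hdy)] with z hzU hzΩ hzx hdz
      have h1 := hfac z ⟨hzΩ, hzU⟩ hdz
      rw [quadraticFactor_coe, Complex.conj_ofReal] at h1
      have h2 : (Qt z - τ) * quadraticFactor β z / ((z - x) ^ 2 * (1 + τ * Qt z)) = M z := by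
        rw [div_eq_iff (mul_ne_zero (pow_ne_zero 2 hzx) hdz), h1]
        ring
      rw [zpow_zero, one_mul, h2]
      exact hM.im_nonneg z hzU)
    ⟨le_rfl, Real.pi_pos.le⟩
  -- multiplying by the positive number `(y - x) ^ 2 * |1 + τ Qt y| ^ 2 / s` leaves
  -- `(Qt y - τ) * conj (1 + τ Qt y)`, with imaginary part `(1 + τ ^ 2) * (Qt y).im`
  have hN : 0 < Complex.normSq (1 + τ * Qt y) := Complex.normSq_pos.2 hdy
  have hyx2 : 0 < (y - x) ^ 2 := by
    have := sub_ne_zero.2 hyx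
    positivity
  have hfrac : (Qt y - τ) * quadraticFactor β y / ((y - x) ^ 2 * (1 + τ * Qt y))
      = ((s / ((y - x) ^ 2 * Complex.normSq (1 + τ * Qt y)) : ℝ) : ℂ)
        * ((Qt y - τ) * conj (1 + τ * Qt y)) := by
    have hconj : conj (1 + τ * Qt y) ≠ 0 := (map_ne_zero _).2 hdy
    rw [hβs]
    push_cast
    rw [← Complex.mul_conj]
    generalize (1 + τ * Qt y) = d at hdy hconj
    field_simp
  have him : ((Qt y - τ) * conj (1 + τ * Qt y)).im = (1 + τ * τ) * (Qt y).im := by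
    simp [Complex.mul_im]
    ring
  simp only [Int.cast_zero, zero_mul, Complex.ofReal_zero, Complex.exp_zero, one_mul, hfrac,
    Complex.im_ofReal_mul, him] at hM
  have h3 : 0 < s / ((y - x) ^ 2 * Complex.normSq (1 + τ * Qt y)) := by positivity
  exact nonneg_of_mul_nonneg_right (nonneg_of_mul_nonneg_right hM h3) hτ

/-! ### Branches of the solution of `Qt z = τ` -/

/-- The equation `(z - z₀) ^ n * f z = f z₀ * w ^ n` has an analytic solution `z = ψ w`, with
`ψ 0 = z₀` and `ψ' 0 = 1`. -/
theorem AnalyticAt.exists_root_parametrization {f : ℂ → ℂ} {z₀ : ℂ} (hf : AnalyticAt ℂ f z₀)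
    (hf0 : f z₀ ≠ 0) {n : ℕ} (hn : n ≠ 0) :
    ∃ ψ : ℂ → ℂ, AnalyticAt ℂ ψ 0 ∧ ψ 0 = z₀ ∧ HasDerivAt ψ 1 0 ∧
      ∀ᶠ w in 𝓝 0, (ψ w - z₀) ^ n * f (ψ w) = f z₀ * w ^ n := by
  set u : ℂ → ℂ := fun z => (z - z₀) * (f z / f z₀) ^ ((n : ℂ)⁻¹) with hu
  have hroot : AnalyticAt ℂ (fun z => (f z / f z₀) ^ ((n : ℂ)⁻¹)) z₀ :=
    (hf.div analyticAt_const hf0).cpow analyticAt_const (by simp [hf0])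
  have hua : AnalyticAt ℂ u z₀ := (analyticAt_id.sub analyticAt_const).mul hroot
  have hu0 : u z₀ = 0 := by simp [hu]
  have hud : HasDerivAt u 1 z₀ := by
    have := ((hasDerivAt_id z₀).sub_const z₀).mul hroot.differentiableAt.hasDerivAt
    exact this.congr_deriv (by simp [hf0])
  have hud' : deriv u z₀ ≠ 0 := by rw [hud.deriv]; exact one_ne_zero
  set ψ := hua.hasStrictDerivAt.localInverse _ _ _ hud' with hψ
  have hψa : AnalyticAt ℂ ψ 0 := hu0 ▸ hua.analyticAt_localInverse hud'
  have hψ0 : ψ 0 = z₀ := by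
    rw [← hu0]
    exact HasStrictFDerivAt.localInverse_apply_image ..
  have hψd : HasDerivAt ψ 1 0 := by
    have h1 : HasDerivAt ψ (deriv u z₀)⁻¹ (u z₀) :=
      (hua.hasStrictDerivAt.to_localInverse hud').hasDerivAt
    have h2 : (deriv u z₀)⁻¹ = 1 := by rw [hud.deriv, inv_one]
    rwa [hu0, h2] at h1
  refine ⟨ψ, hψa, hψ0, hψd, ?_⟩
  -- `u ^ n` is `(z - z₀) ^ n * f z / f z₀`, and `ψ` inverts `u`
  have hright : ∀ᶠ w in 𝓝 0, u (ψ w) = w := by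
    rw [← hu0]
    exact HasStrictDerivAt.eventually_right_inverse ..
  filter_upwards [hright] with w hw
  have h1 : (((f (ψ w) / f z₀) ^ ((n : ℂ)⁻¹)) : ℂ) ^ n = f (ψ w) / f z₀ :=
    Complex.cpow_nat_inv_pow _ hn
  have h2 : w ^ n = (ψ w - z₀) ^ n * (f (ψ w) / f z₀) := by
    rw [← h1, ← mul_pow]
    exact congrArg (· ^ n) hw.symm
  rw [h2]
  field_simp

theorem tendsto_parametrization_slope {ψ : ℂ → ℂ} {z₀ : ℂ} (hψ0 : ψ 0 = z₀)
    (hψd : HasDerivAt ψ 1 0) (ω : ℂ) :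
    Tendsto (fun s : ℝ => (ψ (s * ω) - z₀) / s) (𝓝[>] 0) (𝓝 ω) := by
  have h1 : HasDerivAt (fun s : ℝ => ψ (s * ω)) ω 0 := by
    have h2 : HasDerivAt (fun s : ℝ => (s : ℂ) * ω) ω 0 := by
      simpa using (Complex.ofRealCLM.hasDerivAt (x := (0 : ℝ))).mul_const ω
    have h3 : HasDerivAt ψ 1 (((0 : ℝ) : ℂ) * ω) := by simpa using hψd
    exact (h3.comp (0 : ℝ) h2).congr_deriv (one_mul ω)
  have h4 := h1.tendsto_slope_zero_right
  refine h4.congr fun s => ?_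
  simp [hψ0, div_eq_inv_mul]

/-- The derivative of `τ₀ + (z - z₀) ^ n * f z` has negative real part near the ray through the
direction `ω`, if this holds to leading order. -/
theorem eventually_re_deriv_neg {Qt f : ℂ → ℂ} {c z₀ ω : ℂ} {n : ℕ} (hn : n ≠ 0)
    (hf : AnalyticAt ℂ f z₀) (hQf : ∀ᶠ z in 𝓝 z₀, Qt z = c + (z - z₀) ^ n * f z)
    (hneg : (ω ^ (n - 1) * f z₀).re < 0) :
    ∀ᶠ q : ℝ × ℂ in 𝓝 (0, ω), 0 < q.1 → (deriv Qt (z₀ + q.1 * q.2)).re < 0 := by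
  set k : ℂ → ℂ := fun z => n * f z + (z - z₀) * deriv f z with hk
  have hkc : ContinuousAt k z₀ := by
    have h1 := hf.continuousAt
    have h2 := hf.deriv.continuousAt
    fun_prop
  have hder : ∀ᶠ z in 𝓝 z₀, deriv Qt z = (z - z₀) ^ (n - 1) * k z := by
    filter_upwards [hQf.eventually_nhds, hf.eventually_analyticAt] with z hz hfz
    have h1 : HasDerivAt (fun z => c + (z - z₀) ^ n * f z)
        (n * (z - z₀) ^ (n - 1) * f z + (z - z₀) ^ n * deriv f z) z := by
      have h2 := ((((hasDerivAt_id z).sub_const z₀).pow n).mul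
        hfz.differentiableAt.hasDerivAt).const_add c
      simpa using h2
    rw [Filter.EventuallyEq.deriv_eq hz, h1.deriv, hk]
    obtain ⟨m, rfl⟩ := Nat.exists_eq_succ_of_ne_zero hn
    simp only [Nat.succ_eq_add_one, Nat.add_sub_cancel, pow_succ]
    ring
  have hpt : ContinuousAt (fun q : ℝ × ℂ => z₀ + q.1 * q.2) (0, ω) := by fun_prop
  have hpt0 : z₀ + ((0 : ℝ) : ℂ) * ω = z₀ := by simp
  have hΦ : ContinuousAt (fun q : ℝ × ℂ => (q.2 ^ (n - 1) * k (z₀ + q.1 * q.2)).re) (0, ω) := by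
    have h1 : ContinuousAt (fun q : ℝ × ℂ => k (z₀ + q.1 * q.2)) (0, ω) :=
      ContinuousAt.comp (g := k) (by simpa using hkc) hpt
    exact Complex.continuous_re.continuousAt.comp ((continuousAt_snd.pow _).mul h1)
  have hΦ0 : (ω ^ (n - 1) * k (z₀ + ((0 : ℝ) : ℂ) * ω)).re < 0 := by
    have : ω ^ (n - 1) * k (z₀ + ((0 : ℝ) : ℂ) * ω) = ((n : ℝ) : ℂ) * (ω ^ (n - 1) * f z₀) := by
      simp [hk]; ring
    rw [this, Complex.re_ofReal_mul]
    have : (0 : ℝ) < n := by exact_mod_cast Nat.pos_of_ne_zero hn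
    exact mul_neg_of_pos_of_neg this hneg
  have hpt' : Tendsto (fun q : ℝ × ℂ => z₀ + q.1 * q.2) (𝓝 (0, ω)) (𝓝 z₀) := by
    simpa [ContinuousAt] using hpt
  filter_upwards [hΦ.eventually_lt_const hΦ0, hpt'.eventually hder] with q hq hq' hpos
  rw [hq', add_sub_cancel_left, mul_pow, mul_assoc, ← Complex.ofReal_pow, Complex.re_ofReal_mul]
  exact mul_neg_of_pos_of_neg (pow_pos hpos _) hq

/-- If `Im F ≥ 0` at the real point `x` and `Re F' < 0` on the vertical segment from `x` down to
`x + i y`, then `Im F > 0` at `x + i y`: along the segment, `Im F` has derivative `Re F'`. -/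
theorem im_pos_of_re_deriv_neg {F : ℂ → ℂ} {x y : ℝ} (hy : y < 0)
    (hd : ∀ t ∈ Set.Icc y 0, DifferentiableAt ℂ F (x + t * Complex.I))
    (hneg : ∀ t ∈ Set.Icc y 0, (deriv F (x + t * Complex.I)).re < 0) (h0 : 0 ≤ (F x).im) :
    0 < (F (x + y * Complex.I)).im := by
  have hder : ∀ t ∈ Set.Icc y 0, HasDerivAt (fun t : ℝ => (F (x + t * Complex.I)).im)
      (deriv F (x + t * Complex.I)).re t := by
    intro t ht
    have h1 : HasDerivAt (fun t : ℝ => (x : ℂ) + t * Complex.I) Complex.I t := by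
      simpa using ((Complex.ofRealCLM.hasDerivAt (x := t)).mul_const Complex.I).const_add (x : ℂ)
    have h2 := (hd t ht).hasDerivAt.comp t h1
    have h3 := Complex.imCLM.hasFDerivAt.comp_hasDerivAt t h2
    simpa [Function.comp_def] using h3
  obtain ⟨t, ht, hslope⟩ := exists_hasDerivAt_eq_slope
    (fun t : ℝ => (F (x + t * Complex.I)).im) (fun t => (deriv F (x + t * Complex.I)).re) hy
    (fun t ht => (hder t ht).continuousAt.continuousWithinAt)
    (fun t ht => hder t (Set.Ioo_subset_Icc_self ht))
  have hlt := hneg t (Set.Ioo_subset_Icc_self ht)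
  rw [hslope, div_neg_iff] at hlt
  simp only [Complex.ofReal_zero, zero_mul, add_zero] at hlt
  rcases hlt with h | h <;> linarith [h.1, h.2]

/-- The branch `ψ (s ω)` of the solution of `Qt z = τ₀ + σ s ^ n` that starts in the direction `ω`
is the generalized zero, if `ω` points into the open upper half-plane, or if it is real and
`Qt' < 0` to leading order along `ω`. In the second case the branch cannot enter the lower
half-plane, as `Im Qt ≥ 0` on the real line. -/
theorem eventually_eq_branch {Qt : ℂ → ℂ} {Ω : Set ℂ} {α : ℝ → OnePoint ℂ}
    (hα : ∀ τ, IsExtensionGZNT Qt Ω τ (α τ)) (hΩ : IsOpen Ω) (hQt : DifferentiableOn ℂ Qt Ω)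
    (hnc : ∀ z ∈ Ω, 0 ≤ z.im → ∀ c : ℝ, ¬ ∀ᶠ w in 𝓝[≠] z, Qt w = c)
    {τ₀ z₀ : ℝ} (hx : (z₀ : ℂ) ∈ Ω) (hz₀ : α τ₀ = (z₀ : ℂ))
    {n : ℕ} (hn : n ≠ 0) {f ψ : ℂ → ℂ} (hf : AnalyticAt ℂ f z₀)
    (hQf : ∀ᶠ z in 𝓝 (z₀ : ℂ), Qt z = τ₀ + (z - z₀) ^ n * f z)
    (hψa : AnalyticAt ℂ ψ 0) (hψ0 : ψ 0 = z₀) (hψd : HasDerivAt ψ 1 0)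
    (hψ : ∀ᶠ w in 𝓝 0, (ψ w - z₀) ^ n * f (ψ w) = f z₀ * w ^ n)
    {σ : ℝ} {ω : ℂ} (hω : f z₀ * ω ^ n = σ)
    (hdir : 0 < ω.im ∨ (ω.im = 0 ∧ σ * ω.re < 0)) :
    ∀ᶠ s : ℝ in 𝓝[>] 0, α (τ₀ + σ * s ^ n) = (ψ (s * ω) : ℂ) := by
  have hslope := tendsto_parametrization_slope hψ0 hψd ω
  have hs0 : Tendsto (fun s : ℝ => (s : ℂ) * ω) (𝓝[>] 0) (𝓝 0) := by
    have : Continuous (fun s : ℝ => (s : ℂ) * ω) := by fun_prop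
    simpa using (this.tendsto 0).mono_left nhdsWithin_le_nhds
  have hψs : Tendsto (fun s : ℝ => ψ (s * ω)) (𝓝[>] 0) (𝓝 (z₀ : ℂ)) := by
    have := hψa.continuousAt.tendsto.comp hs0
    rwa [hψ0] at this
  have hsol : ∀ᶠ s : ℝ in 𝓝[>] 0, ψ (s * ω) ∈ Ω ∧
      Qt (ψ (s * ω)) = ((τ₀ + σ * s ^ n : ℝ) : ℂ) := by
    filter_upwards [hψs.eventually hQf, hs0.eventually hψ, hψs.eventually (hΩ.mem_nhds hx)]
      with s h1 h2 h3
    refine ⟨h3, ?_⟩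
    rw [h1, h2, mul_pow]
    push_cast
    linear_combination (s : ℂ) ^ n * hω
  have hform : ∀ s : ℝ, 0 < s → ψ (s * ω) = z₀ + s * ((ψ (s * ω) - z₀) / s) := by
    intro s hs
    have : (s : ℂ) ≠ 0 := by exact_mod_cast hs.ne'
    field_simp
    ring
  have him : ∀ s : ℝ, 0 < s → (ψ (s * ω)).im = s * ((ψ (s * ω) - z₀) / s).im := by
    intro s hs
    conv_lhs => rw [hform s hs]
    simp
  rcases hdir with hdir | ⟨hω0, hdir⟩
  · have himpos := ((Complex.continuous_im.tendsto ω).comp hslope).eventually_const_lt hdir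
    filter_upwards [hsol, himpos, self_mem_nhdsWithin] with s ⟨h1, h2⟩ h3 hs
    have hpos : 0 < (ψ (s * ω)).im := by
      rw [him s hs]; exact mul_pos hs h3
    exact (hα _).eq_of_im_pos hΩ hQt h1 hpos (hnc _ h1 hpos.le _) h2
  · have hωre : (ω.re : ℂ) = ω := Complex.ext rfl hω0.symm
    have hωne : ω.re ≠ 0 := by rintro h; simp [h] at hdir
    have hneg : (ω ^ (n - 1) * f z₀).re < 0 := by
      have h1 : (ω ^ (n - 1) * f z₀).re * ω.re = σ := by
        have h2 : ω ^ (n - 1) * f z₀ * ω = σ := by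
          rw [← hω, ← Nat.sub_add_cancel (Nat.pos_of_ne_zero hn), Nat.add_sub_cancel, pow_succ]
          ring
        have h3 := congrArg Complex.re h2
        rwa [← hωre, Complex.re_mul_ofReal, hωre, Complex.ofReal_re] at h3
      have h4 : (ω ^ (n - 1) * f z₀).re * (ω.re * ω.re) < 0 := by
        rw [← mul_assoc, h1]; exact hdir
      have h5 : 0 < ω.re * ω.re := mul_self_pos.2 hωne
      by_contra hcon
      nlinarith [mul_nonneg (not_lt.1 hcon) h5.le]
    have hval : Qt z₀ = τ₀ := by
      have := hQf.self_of_nhds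
      simpa [hn] using this
    have hderneg := eventually_re_deriv_neg hn hf hQf hneg
    have hreal := (hz₀ ▸ hα τ₀ : IsExtensionGZNT Qt Ω τ₀ (z₀ : ℂ)).eventually_im_nonneg
      hΩ hQt hx hval
    have hΩ' : ∀ᶠ q : ℝ × ℂ in 𝓝 (0, ω), (z₀ + q.1 * q.2 : ℂ) ∈ Ω := by
      have : ContinuousAt (fun q : ℝ × ℂ => (z₀ + q.1 * q.2 : ℂ)) (0, ω) := by fun_prop
      refine this.eventually (hΩ.mem_nhds ?_)
      simpa using hx
    obtain ⟨δ, hδ, hball⟩ := Metric.eventually_nhds_iff.1 (hderneg.and hΩ')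
    have hrepart : Tendsto (fun s : ℝ => z₀ + s * ((ψ (s * ω) - z₀) / s).re) (𝓝[>] 0)
        (𝓝 z₀) := by
      have h1 := (Complex.continuous_re.tendsto ω).comp hslope
      have h2 : Tendsto (fun s : ℝ => s) (𝓝[>] 0) (𝓝 0) := nhdsWithin_le_nhds
      simpa using (tendsto_const_nhds (x := z₀)).add (h2.mul h1)
    filter_upwards [hsol, hslope.eventually (Metric.ball_mem_nhds ω hδ), self_mem_nhdsWithin,
      mem_nhdsWithin_of_mem_nhds (Iio_mem_nhds hδ), hrepart.eventually hreal]
      with s ⟨h1, h2⟩ hv hs hsδ hnn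
    have hs : 0 < s := hs
    have hsδ : s < δ := hsδ
    set v := (ψ (s * ω) - z₀) / s with hvdef
    -- as `ω` is real, moving `v` vertically towards the real line keeps it close to `ω`
    have hseg : ∀ b : ℝ, |b| ≤ |v.im| →
        (deriv Qt (z₀ + s * (v.re + b * Complex.I))).re < 0 ∧
          (z₀ + s * (v.re + b * Complex.I) : ℂ) ∈ Ω := by
      intro b hb
      have hdist : dist ((s, v.re + b * Complex.I) : ℝ × ℂ) (0, ω) < δ := by
        rw [Prod.dist_eq, max_lt_iff]
        refine ⟨by simpa [abs_of_pos hs] using hsδ, lt_of_le_of_lt ?_ hv⟩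
        rw [dist_eq_norm, dist_eq_norm, Complex.norm_eq_sqrt_sq_add_sq,
          Complex.norm_eq_sqrt_sq_add_sq]
        apply Real.sqrt_le_sqrt
        have := sq_le_sq.2 hb
        simpa [hω0] using this
      exact ⟨(hball hdist).1 hs, (hball hdist).2⟩
    have hz1 : ψ (s * ω) = ((z₀ + s * v.re : ℝ) : ℂ) + ((s * v.im : ℝ) : ℂ) * Complex.I := by
      rw [hform s hs, ← hvdef]
      conv_lhs => rw [← Complex.re_add_im v]
      push_cast
      ring
    rcases lt_trichotomy v.im 0 with hlt | heq | hgt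
    · exfalso
      have hpt : ∀ t : ℝ, (((z₀ + s * v.re : ℝ) : ℂ) + t * Complex.I)
          = z₀ + s * (v.re + ((t / s : ℝ) : ℂ) * Complex.I) := by
        intro t
        have : (s : ℂ) ≠ 0 := by exact_mod_cast hs.ne'
        push_cast
        field_simp
        ring
      have hb : ∀ t ∈ Set.Icc (s * v.im) 0, |t / s| ≤ |v.im| := by
        intro t ht
        rw [abs_div, abs_of_pos hs, div_le_iff₀ hs, abs_of_nonpos ht.2, abs_of_neg hlt]
        linarith [ht.1]
      have := im_pos_of_re_deriv_neg (F := Qt) (x := z₀ + s * v.re) (y := s * v.im)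
        (mul_neg_of_pos_of_neg hs hlt)
        (fun t ht => by
          rw [hpt]
          exact hQt.differentiableAt (hΩ.mem_nhds (hseg _ (hb t ht)).2))
        (fun t ht => by rw [hpt]; exact (hseg _ (hb t ht)).1) hnn
      rw [← hz1, h2, Complex.ofReal_im] at this
      exact lt_irrefl _ this
    · have hz1' : ψ (s * ω) = ((z₀ + s * v.re : ℝ) : ℂ) := by
        rw [hz1, heq]; simp
      have h3 := (hseg 0 (by simp)).1
      have h4 : (z₀ + s * (v.re + ((0 : ℝ) : ℂ) * Complex.I) : ℂ) = ψ (s * ω) := by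
        rw [hz1']; push_cast; ring
      rw [h4] at h3
      rw [hz1'] at h1 h2 h3 ⊢
      exact (hα _).eq_of_real hΩ hQt h1 h2 h3
    · have hpos : 0 < (ψ (s * ω)).im := by
        rw [him s hs]; exact mul_pos hs hgt
      exact (hα _).eq_of_im_pos hΩ hQt h1 hpos (hnc _ h1 hpos.le _) h2

/-! ### Limits of arguments -/

theorem continuousWithinAt_arg_of_im_nonneg {ω : ℂ} (hω : ω ≠ 0) :
    ContinuousWithinAt Complex.arg {z : ℂ | 0 ≤ z.im} ω := by
  by_cases hs : ω ∈ Complex.slitPlane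
  · exact (Complex.continuousAt_arg hs).continuousWithinAt
  · rw [Complex.mem_slitPlane_iff, not_or, not_lt, not_not] at hs
    exact Complex.continuousWithinAt_arg_of_re_neg_of_im_zero
      (lt_of_le_of_ne hs.1 fun h => hω (Complex.ext h hs.2)) hs.2

/-- A solution of `c * ω ^ n = σ` with a prescribed argument `φ ∈ [0, π]`. -/
theorem exists_mul_pow_eq_of_arg {c : ℂ} (hc : c ≠ 0) {n : ℕ} (hn : n ≠ 0) {φ σ : ℝ}
    (hφ : φ ∈ Set.Icc 0 Real.pi)
    (hσ : Complex.exp (((c.arg + n * φ : ℝ) : ℂ) * Complex.I) = σ)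
    (hdir : 0 < Real.sin φ ∨ (Real.sin φ = 0 ∧ σ * Real.cos φ < 0)) :
    ∃ ω : ℂ, ω ≠ 0 ∧ c * ω ^ n = σ ∧ ω.arg = φ ∧
      (0 < ω.im ∨ (ω.im = 0 ∧ σ * ω.re < 0)) := by
  set ρ : ℝ := (‖c‖⁻¹) ^ ((n : ℝ)⁻¹) with hρ
  have hcpos : 0 < ‖c‖ := norm_pos_iff.2 hc
  have hρpos : 0 < ρ := Real.rpow_pos_of_pos (inv_pos.2 hcpos) _
  have hρn : ρ ^ n = ‖c‖⁻¹ := Real.rpow_inv_natCast_pow (inv_pos.2 hcpos).le hn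
  have hre : ((ρ : ℂ) * Complex.exp (φ * Complex.I)).re = ρ * Real.cos φ := by
    rw [Complex.re_ofReal_mul, Complex.exp_ofReal_mul_I_re]
  have him : ((ρ : ℂ) * Complex.exp (φ * Complex.I)).im = ρ * Real.sin φ := by
    rw [Complex.im_ofReal_mul, Complex.exp_ofReal_mul_I_im]
  refine ⟨ρ * Complex.exp (φ * Complex.I), ?_, ?_, ?_, ?_⟩
  · exact mul_ne_zero (by exact_mod_cast hρpos.ne') (Complex.exp_ne_zero _)
  · conv_lhs => rw [← Complex.norm_mul_exp_arg_mul_I c]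
    rw [← hσ, mul_pow, ← Complex.ofReal_pow, hρn, ← Complex.exp_nat_mul]
    have hc' : (‖c‖ : ℂ) ≠ 0 := by exact_mod_cast hcpos.ne'
    push_cast
    rw [add_mul, Complex.exp_add, ← mul_assoc (n : ℂ)]
    field_simp
  · rw [Complex.arg_real_mul _ hρpos, Complex.exp_mul_I]
    exact Complex.arg_cos_add_sin_mul_I ⟨by linarith [hφ.1, Real.pi_pos], hφ.2⟩
  · rw [him, hre]
    rcases hdir with h | ⟨h1, h2⟩
    · exact Or.inl (mul_pos hρpos h)
    · refine Or.inr ⟨by rw [h1, mul_zero], ?_⟩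
      have := mul_neg_of_pos_of_neg hρpos h2
      linarith

/-! ### One-sided behaviour of the generalized zero -/

/-- The consequences of `α = ψ (s ω)`, `s = |τ - τ₀| ^ (1 / n)`, on the side `σ (τ - τ₀) > 0`. -/
theorem exists_one_sided_expansion {α : ℝ → OnePoint ℂ}
    (hα : ∀ τ, α τ ∈ closedUpperHalfSphere) {a : ℝ → ℂ}
    (ha : ∀ τ z, α τ = ((z : ℂ) : OnePoint ℂ) → a τ = z)
    {τ₀ z₀ : ℝ} {n : ℕ} (hn : n ≠ 0) {ψ : ℂ → ℂ}
    (hψa : AnalyticAt ℂ ψ 0) (hψ0 : ψ 0 = z₀) (hψd : HasDerivAt ψ 1 0)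
    {σ : ℝ} (hσ : σ * σ = 1) {ω : ℂ} (hω : ω ≠ 0)
    (hbr : ∀ᶠ s : ℝ in 𝓝[>] 0, α (τ₀ + σ * s ^ n) = (ψ (s * ω) : ℂ)) :
    (∃ ε > 0, ∀ τ, 0 < σ * (τ - τ₀) → σ * (τ - τ₀) < ε →
      α τ = (a τ : OnePoint ℂ) ∧ a τ ≠ z₀ ∧ AnalyticAt ℝ a τ ∧
        a τ = ψ (((σ * (τ - τ₀)) ^ ((n : ℝ)⁻¹) : ℝ) * ω)) ∧
      Tendsto a (𝓝[{τ | 0 < σ * (τ - τ₀)}] τ₀) (𝓝 z₀) ∧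
      Tendsto (fun τ => (a τ - z₀).arg) (𝓝[{τ | 0 < σ * (τ - τ₀)}] τ₀) (𝓝 ω.arg) := by
  set s : ℝ → ℝ := fun τ => (σ * (τ - τ₀)) ^ ((n : ℝ)⁻¹) with hs
  have hn' : (0 : ℝ) < (n : ℝ)⁻¹ := inv_pos.2 (by exact_mod_cast Nat.pos_of_ne_zero hn)
  have hspos : ∀ τ, 0 < σ * (τ - τ₀) → 0 < s τ := fun τ h => Real.rpow_pos_of_pos h _
  have hspow : ∀ τ, 0 < σ * (τ - τ₀) → τ₀ + σ * s τ ^ n = τ := by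
    intro τ h
    rw [hs]
    simp only
    rw [Real.rpow_inv_natCast_pow h.le hn, ← mul_assoc, hσ]
    ring
  have hstend : Tendsto s (𝓝[{τ | 0 < σ * (τ - τ₀)}] τ₀) (𝓝[>] 0) := by
    refine tendsto_nhdsWithin_iff.2 ⟨?_, ?_⟩
    · have : ContinuousAt s τ₀ :=
        ContinuousAt.rpow_const (by fun_prop) (Or.inr hn'.le)
      have h0 : s τ₀ = 0 := by simp [hs, hn]
      rw [← h0]
      exact this.tendsto.mono_left nhdsWithin_le_nhds
    · filter_upwards [self_mem_nhdsWithin] with τ hτ using hspos τ hτ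
  have hslope := tendsto_parametrization_slope hψ0 hψd ω
  have hs0 : Tendsto (fun s : ℝ => (s : ℂ) * ω) (𝓝[>] 0) (𝓝 0) := by
    have : Continuous (fun s : ℝ => (s : ℂ) * ω) := by fun_prop
    simpa using (this.tendsto 0).mono_left nhdsWithin_le_nhds
  have hψs : Tendsto (fun s : ℝ => ψ (s * ω)) (𝓝[>] 0) (𝓝 (z₀ : ℂ)) := by
    have := hψa.continuousAt.tendsto.comp hs0
    rwa [hψ0] at this
  have hgood : ∀ᶠ s : ℝ in 𝓝[>] 0, α (τ₀ + σ * s ^ n) = (ψ (s * ω) : ℂ) ∧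
      ψ (s * ω) ≠ z₀ ∧ AnalyticAt ℂ ψ (s * ω) := by
    filter_upwards [hbr, hslope.eventually_ne hω, hs0.eventually hψa.eventually_analyticAt]
      with s h1 h2 h3
    refine ⟨h1, fun h => h2 (by rw [h, sub_self, zero_div]), h3⟩
  have hav : ∀ τ, 0 < σ * (τ - τ₀) → α (τ₀ + σ * s τ ^ n) = (ψ (s τ * ω) : ℂ) →
      α τ = (a τ : OnePoint ℂ) ∧ a τ = ψ (s τ * ω) := by
    intro τ hτ h
    rw [hspow τ hτ] at h
    rw [ha τ _ h]
    exact ⟨h, rfl⟩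
  have hev : ∀ᶠ τ in 𝓝[{τ | 0 < σ * (τ - τ₀)}] τ₀,
      α τ = (a τ : OnePoint ℂ) ∧ a τ = ψ (s τ * ω) := by
    filter_upwards [hstend.eventually hgood, self_mem_nhdsWithin] with τ h hτ
    exact hav τ hτ h.1
  refine ⟨?_, ?_, ?_⟩
  · obtain ⟨δ, hδ, hsub⟩ := mem_nhdsGT_iff_exists_Ioo_subset.1 hgood
    have hδ : 0 < δ := hδ
    have hall : ∀ τ, 0 < σ * (τ - τ₀) → σ * (τ - τ₀) < δ ^ n →
        α (τ₀ + σ * s τ ^ n) = (ψ (s τ * ω) : ℂ) ∧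
          ψ (s τ * ω) ≠ z₀ ∧ AnalyticAt ℂ ψ (s τ * ω) := by
      intro τ h1 h2
      refine hsub ⟨hspos τ h1, ?_⟩
      rw [← Real.pow_rpow_inv_natCast hδ.le hn]
      exact Real.rpow_lt_rpow h1.le h2 hn'
    refine ⟨δ ^ n, pow_pos hδ n, fun τ h1 h2 => ?_⟩
    obtain ⟨h3, h4, h5⟩ := hall τ h1 h2
    obtain ⟨h6, h7⟩ := hav τ h1 h3
    refine ⟨h6, by rwa [h7], ?_, h7⟩
    have hsa : AnalyticAt ℝ s τ := by
      have hlin : AnalyticAt ℝ (fun τ => σ * (τ - τ₀)) τ := by fun_prop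
      exact AnalyticAt.comp (g := fun x : ℝ => x ^ ((n : ℝ)⁻¹))
        (Real.contDiffAt_rpow_const_of_ne (n := ⊤) h1.ne').analyticAt hlin
    have hin : AnalyticAt ℝ (fun τ => (s τ : ℂ) * ω) τ :=
      ((Complex.ofRealCLM.analyticAt _).comp hsa).mul analyticAt_const
    have hcomp : AnalyticAt ℝ (fun τ => ψ (s τ * ω)) τ :=
      AnalyticAt.comp (g := ψ) (f := fun τ => (s τ : ℂ) * ω) h5.restrictScalars hin
    refine hcomp.congr ?_
    have hc : ContinuousAt (fun τ => σ * (τ - τ₀)) τ := by fun_prop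
    filter_upwards [hc.eventually_const_lt h1, hc.eventually_lt_const h2] with τ' h1' h2'
    exact (hav τ' h1' (hall τ' h1' h2').1).2.symm
  · refine (hψs.comp hstend).congr' ?_
    filter_upwards [hev] with τ h using h.2.symm
  · have hlim : Tendsto (fun τ => (ψ (s τ * ω) - z₀) / (s τ : ℂ))
        (𝓝[{τ | 0 < σ * (τ - τ₀)}] τ₀) (𝓝[{z : ℂ | 0 ≤ z.im}] ω) := by
      refine tendsto_nhdsWithin_iff.2 ⟨hslope.comp hstend, ?_⟩
      filter_upwards [hev, self_mem_nhdsWithin] with τ h hτ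
      have h1 : 0 ≤ (a τ).im := hα τ _ h.1
      rw [h.2] at h1
      change 0 ≤ ((ψ (s τ * ω) - z₀) / (s τ : ℂ)).im
      rw [Complex.div_ofReal_im, Complex.sub_im, Complex.ofReal_im, sub_zero]
      exact div_nonneg h1 (hspos τ hτ).le
    refine ((continuousWithinAt_arg_of_im_nonneg hω).tendsto.comp hlim).congr' ?_
    filter_upwards [hev, self_mem_nhdsWithin] with τ h hτ
    have hinv : 0 < (s τ)⁻¹ := inv_pos.2 (hspos τ hτ)
    rw [Function.comp_apply, div_eq_inv_mul, ← Complex.ofReal_inv, Complex.arg_real_mul _ hinv,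
      h.2]

/-! ### Taylor coefficients -/

theorem iteratedDeriv_of_eventuallyEq_pow_mul {z₀ : ℂ} (m : ℕ) : ∀ {F f : ℂ → ℂ},
    AnalyticAt ℂ f z₀ → (∀ᶠ z in 𝓝 z₀, F z = (z - z₀) ^ m * f z) →
    (∀ j < m, iteratedDeriv j F z₀ = 0) ∧ iteratedDeriv m F z₀ = m.factorial * f z₀ := by
  induction m with
  | zero =>
    intro F f _ hF
    simpa using hF.self_of_nhds
  | succ m ih =>
    intro F f hf hF
    have hder : ∀ᶠ z in 𝓝 z₀, deriv F z
        = (z - z₀) ^ m * ((m + 1) * f z + (z - z₀) * deriv f z) := by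
      filter_upwards [hF.eventually_nhds, hf.eventually_analyticAt] with z hz hfz
      have h1 := (((hasDerivAt_id z).sub_const z₀).pow (m + 1)).mul
        hfz.differentiableAt.hasDerivAt
      have h2 : deriv F z = _ := (h1.congr_of_eventuallyEq hz).deriv
      rw [h2]
      simp [pow_succ]
      ring
    have han : AnalyticAt ℂ (fun z => (m + 1) * f z + (z - z₀) * deriv f z) z₀ := by
      have := hf.deriv
      fun_prop
    obtain ⟨h1, h2⟩ := ih han hder
    refine ⟨fun j hj => ?_, ?_⟩
    · cases j with
      | zero => simpa using hF.self_of_nhds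
      | succ j =>
        rw [iteratedDeriv_succ']
        exact h1 j (by omega)
    · rw [iteratedDeriv_succ', h2, Nat.factorial_succ]
      push_cast
      ring

/-- The derivatives at `z₀` of `c + (z - z₀) ^ n * f z` up to order `n`. -/
theorem iteratedDeriv_of_eventuallyEq_const_add {z₀ c : ℂ} {n : ℕ} {F f : ℂ → ℂ}
    (hf : AnalyticAt ℂ f z₀) (hF : ∀ᶠ z in 𝓝 z₀, F z = c + (z - z₀) ^ n * f z) {j : ℕ}
    (hj : 0 < j) :
    (j < n → iteratedDeriv j F z₀ = 0) ∧
      (j = n → iteratedDeriv j F z₀ = n.factorial * f z₀) := by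
  obtain ⟨h1, h2⟩ := iteratedDeriv_of_eventuallyEq_pow_mul n (F := fun z => F z - c) hf
    (by filter_upwards [hF] with z hz; rw [hz]; ring)
  obtain ⟨i, rfl⟩ := Nat.exists_eq_succ_of_ne_zero hj.ne'
  have hshift : iteratedDeriv (i + 1) (fun z => F z - c) z₀ = iteratedDeriv (i + 1) F z₀ := by
    rw [iteratedDeriv_succ', iteratedDeriv_succ']
    congr 1
    ext z
    exact deriv_sub_const c
  simp only [Nat.succ_eq_add_one, ← hshift]
  exact ⟨h1 _, by rintro rfl; exact h2⟩

/-! ### The extension and its generalized zeros near `τ₀` -/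

/-- The extension of a function in `N₁` is not a real constant near any point of the closed upper
half-plane. -/
theorem IsN1.extension_not_eventually_eq_real {Q Qt : ℂ → ℂ} (hQ : IsN1 Q) {Ω : Set ℂ}
    (hΩ : IsOpen Ω) (hext : Q =ᶠ[codiscreteWithin (Ω ∩ upperHalfPlaneSet)] Qt) {z : ℂ}
    (hz : z ∈ Ω) (hzim : 0 ≤ z.im) (c : ℝ) : ¬ ∀ᶠ w in 𝓝[≠] z, Qt w = c := by
  intro h
  rw [eventually_nhdsWithin_iff] at h
  obtain ⟨r, hr, hball⟩ := Metric.eventually_nhds_iff_ball.1 (h.and (hΩ.mem_nhds hz))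
  set z₁ : ℂ := z + (r / 2 : ℝ) * Complex.I with hz₁
  have hz₁b : z₁ ∈ Metric.ball z r := by
    rw [Metric.mem_ball, dist_eq_norm, hz₁, add_sub_cancel_left, norm_mul, Complex.norm_I,
      Complex.norm_real, Real.norm_eq_abs, abs_of_pos (by linarith)]
    linarith
  have hz₁U : z₁ ∈ upperHalfPlaneSet := by
    have : 0 < z.im + r / 2 := by linarith
    simpa [upperHalfPlaneSet, hz₁] using this
  have hne : z₁ ≠ z := by
    simp [hz₁, hr.ne']
  apply hQ.not_eventually_eq_real hz₁U c
  filter_upwards [eventually_nhdsNE_of_codiscreteWithin (hΩ.inter isOpen_upperHalfPlaneSet) hext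
      ⟨(hball z₁ hz₁b).2, hz₁U⟩,
    mem_nhdsWithin_of_mem_nhds (Metric.isOpen_ball.mem_nhds hz₁b),
    mem_nhdsWithin_of_mem_nhds (isOpen_ne.mem_nhds hne)] with w h1 h2 h3
  rw [h1]
  exact (hball w h2).1 h3

/-- The one-sided expansions on both sides of `τ₀`, put together. For `n = 1` both are given by
the same analytic function of `τ - τ₀`. -/
theorem exists_two_sided_expansion {α : ℝ → OnePoint ℂ}
    (hα : ∀ τ, α τ ∈ closedUpperHalfSphere) {a : ℝ → ℂ}
    (ha : ∀ τ z, α τ = ((z : ℂ) : OnePoint ℂ) → a τ = z)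
    {τ₀ z₀ : ℝ} (hz₀ : α τ₀ = ((z₀ : ℂ) : OnePoint ℂ))
    {n : ℕ} (hn : n ≠ 0) {ψ : ℂ → ℂ}
    (hψa : AnalyticAt ℂ ψ 0) (hψ0 : ψ 0 = z₀) (hψd : HasDerivAt ψ 1 0)
    {c ω₁ ω₂ : ℂ} (hc : c ≠ 0) (hω₁ : ω₁ ≠ 0) (hω₂ : ω₂ ≠ 0)
    (hcω₁ : c * ω₁ ^ n = (1 : ℝ)) (hcω₂ : c * ω₂ ^ n = (-1 : ℝ))
    (hbr₁ : ∀ᶠ s : ℝ in 𝓝[>] 0, α (τ₀ + (1 : ℝ) * s ^ n) = (ψ (s * ω₁) : ℂ))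
    (hbr₂ : ∀ᶠ s : ℝ in 𝓝[>] 0, α (τ₀ + (-1 : ℝ) * s ^ n) = (ψ (s * ω₂) : ℂ)) :
    ∃ ε > 0, (∀ τ ∈ Set.Ioo (τ₀ - ε) (τ₀ + ε), α τ = (a τ : OnePoint ℂ)) ∧
      (∀ τ ∈ Set.Ioo (τ₀ - ε) (τ₀ + ε), τ ≠ τ₀ → a τ ≠ (z₀ : ℂ)) ∧
      Tendsto a (𝓝 τ₀) (𝓝 (z₀ : ℂ)) ∧
      (n = 1 → AnalyticOnNhd ℝ a (Set.Ioo (τ₀ - ε) (τ₀ + ε))) ∧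
      AnalyticOnNhd ℝ a (Set.Ioo (τ₀ - ε) τ₀) ∧
      AnalyticOnNhd ℝ a (Set.Ioo τ₀ (τ₀ + ε)) ∧
      Tendsto (fun τ => (a τ - z₀).arg) (𝓝[>] τ₀) (𝓝 ω₁.arg) ∧
      Tendsto (fun τ => (a τ - z₀).arg) (𝓝[<] τ₀) (𝓝 ω₂.arg) := by
  obtain ⟨⟨ε₁, hε₁, h₁⟩, hlim₁, harg₁⟩ := exists_one_sided_expansion hα ha hn hψa hψ0 hψd
    (σ := 1) (by norm_num) hω₁ hbr₁
  obtain ⟨⟨ε₂, hε₂, h₂⟩, hlim₂, harg₂⟩ := exists_one_sided_expansion hα ha hn hψa hψ0 hψd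
    (σ := -1) (by norm_num) hω₂ hbr₂
  have hset₁ : {τ : ℝ | 0 < 1 * (τ - τ₀)} = Set.Ioi τ₀ := by
    ext τ; simp
  have hset₂ : {τ : ℝ | 0 < -1 * (τ - τ₀)} = Set.Iio τ₀ := by
    ext τ; simp
  rw [hset₁] at hlim₁ harg₁
  rw [hset₂] at hlim₂ harg₂
  have haτ₀ : a τ₀ = z₀ := ha _ _ hz₀
  have hright : ∀ τ, τ₀ < τ → τ < τ₀ + min ε₁ ε₂ → _ := fun τ hτ hτ' =>
    h₁ τ (by linarith) (by linarith [min_le_left ε₁ ε₂])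
  have hleft : ∀ τ, τ < τ₀ → τ₀ - min ε₁ ε₂ < τ → _ := fun τ hτ hτ' =>
    h₂ τ (by linarith) (by linarith [min_le_right ε₁ ε₂])
  have hε : 0 < min ε₁ ε₂ := lt_min hε₁ hε₂
  refine ⟨min ε₁ ε₂, hε, ?_, ?_, ?_, ?_, ?_, ?_, harg₁, harg₂⟩
  · rintro τ ⟨hτ, hτ'⟩
    rcases lt_trichotomy τ τ₀ with h | h | h
    · exact (hleft τ h hτ).1
    · rw [h, haτ₀, hz₀]
    · exact (hright τ h hτ').1
  · rintro τ ⟨hτ, hτ'⟩ hne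
    rcases lt_or_gt_of_ne hne with h | h
    · exact (hleft τ h hτ).2.1
    · exact (hright τ h hτ').2.1
  · have hcont : ContinuousAt a τ₀ := by
      refine continuousAt_iff_continuous_left'_right'.2 ⟨?_, ?_⟩
      · rw [ContinuousWithinAt, haτ₀]; exact hlim₂
      · rw [ContinuousWithinAt, haτ₀]; exact hlim₁
    rw [← haτ₀]
    exact hcont
  · rintro hn1 τ ⟨hτ, hτ'⟩
    rcases lt_trichotomy τ τ₀ with h | rfl | h
    · exact (hleft τ h hτ).2.2.1
    · have han : AnalyticAt ℝ (fun t : ℝ => ψ (((t - τ : ℝ) : ℂ) * ω₁)) τ := by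
        have hin : AnalyticAt ℝ (fun t : ℝ => ((t - τ : ℝ) : ℂ) * ω₁) τ :=
          ((Complex.ofRealCLM.analyticAt _).comp (f := fun t : ℝ => t - τ)
            (by fun_prop)).mul analyticAt_const
        refine AnalyticAt.comp (g := ψ) (f := fun t : ℝ => ((t - τ : ℝ) : ℂ) * ω₁) ?_ hin
        simpa using hψa.restrictScalars (𝕜 := ℝ)
      refine han.congr ?_
      filter_upwards [Ioo_mem_nhds (show τ - min ε₁ ε₂ < τ by linarith)
        (show τ < τ + min ε₁ ε₂ by linarith)] with t ht
      have hω : ω₂ = -ω₁ := by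
        apply mul_left_cancel₀ hc
        rw [hn1, pow_one] at hcω₁ hcω₂
        rw [hcω₂, mul_neg, hcω₁]
        simp
      rcases lt_trichotomy t τ with h | h | h
      · rw [(hleft t h ht.1).2.2.2, hω, hn1]
        congr 1
        push_cast
        simp
        ring
      · rw [h, haτ₀]; simp [hψ0]
      · rw [(hright t h ht.2).2.2.2, hn1]
        simp
    · exact (hright τ h hτ').2.2.1
  · exact fun τ hτ => (hleft τ hτ.2 hτ.1).2.2.1
  · exact fun τ hτ => (hright τ hτ.1 hτ.2).2.2.1

theorem mainTheorem3 (Q : ℂ → ℂ) (hQ : IsN1 Q)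
    (α : ℝ → OnePoint ℂ) (hα : ∀ τ : ℝ, IsGZNT (moebiusTransform Q τ) (α τ))
    (τ₀ z₀ : ℝ) (hz₀ : α τ₀ = ((z₀ : ℂ) : OnePoint ℂ))
    (Ω : Set ℂ) (hΩ : IsOpen Ω) (hz₀Ω : (z₀ : ℂ) ∈ Ω)
    (Qt : ℂ → ℂ) (hQt : DifferentiableOn ℂ Qt Ω)
    (hext : Q =ᶠ[codiscreteWithin (Ω ∩ upperHalfPlaneSet)] Qt) :
    ∃ (ε : ℝ) (a : ℝ → ℂ), 0 < ε ∧
      (∀ τ ∈ Set.Ioo (τ₀ - ε) (τ₀ + ε), α τ = (a τ : OnePoint ℂ)) ∧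
      (∀ τ ∈ Set.Ioo (τ₀ - ε) (τ₀ + ε), τ ≠ τ₀ → a τ ≠ (z₀ : ℂ)) ∧
      Tendsto a (𝓝 τ₀) (𝓝 (z₀ : ℂ)) ∧
      ((((deriv Qt z₀).im = 0 ∧ (deriv Qt z₀).re < 0) ∧
          AnalyticOnNhd ℝ a (Set.Ioo (τ₀ - ε) (τ₀ + ε)) ∧
          Tendsto (fun τ => (a τ - z₀).arg) (𝓝[<] τ₀) (𝓝 0) ∧
          Tendsto (fun τ => (a τ - z₀).arg) (𝓝[>] τ₀) (𝓝 Real.pi)) ∨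
        ((deriv Qt z₀ = 0 ∧ iteratedDeriv 2 Qt z₀ ≠ 0) ∧
          0 ≤ (iteratedDeriv 2 Qt z₀).im ∧
          AnalyticOnNhd ℝ a (Set.Ioo (τ₀ - ε) τ₀) ∧
          AnalyticOnNhd ℝ a (Set.Ioo τ₀ (τ₀ + ε)) ∧
          Tendsto (fun τ => (a τ - z₀).arg) (𝓝[>] τ₀)
            (𝓝 ((2 * Real.pi - (iteratedDeriv 2 Qt z₀).arg) / 2)) ∧
          Tendsto (fun τ => (a τ - z₀).arg) (𝓝[<] τ₀)
            (𝓝 ((Real.pi - (iteratedDeriv 2 Qt z₀).arg) / 2))) ∨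
        ((deriv Qt z₀ = 0 ∧ iteratedDeriv 2 Qt z₀ = 0 ∧ iteratedDeriv 3 Qt z₀ ≠ 0) ∧
          AnalyticOnNhd ℝ a (Set.Ioo (τ₀ - ε) τ₀) ∧
          AnalyticOnNhd ℝ a (Set.Ioo τ₀ (τ₀ + ε)) ∧
          Tendsto (fun τ => (a τ - z₀).arg) (𝓝[<] τ₀) (𝓝 (Real.pi / 3)) ∧
          Tendsto (fun τ => (a τ - z₀).arg) (𝓝[>] τ₀) (𝓝 (2 * Real.pi / 3)))) := by
  have hloc : ∀ τ, IsExtensionGZNT Qt Ω τ (α τ) := fun τ => (hα τ).isExtensionGZNT hΩ hQt hext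
  have hnc : ∀ z ∈ Ω, 0 ≤ z.im → ∀ c : ℝ, ¬ ∀ᶠ w in 𝓝[≠] z, Qt w = c := fun z hz hzim c =>
    hQ.extension_not_eventually_eq_real hΩ hext hz hzim c
  obtain ⟨n, f, hf, hf0, hQf, hcases⟩ :=
    (hz₀ ▸ hloc τ₀ : IsExtensionGZNT Qt Ω τ₀ (z₀ : ℂ)).order_at hΩ hQt hz₀Ω
      fun c hc => hnc _ hz₀Ω (by simp) c (hc.filter_mono nhdsWithin_le_nhds)
  have hn : n ≠ 0 := by rcases hcases with h | h | h <;> omega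
  obtain ⟨ψ, hψa, hψ0, hψd, hψ⟩ := hf.exists_root_parametrization hf0 hn
  -- the value `z₀` in place of `∞` is irrelevant, as `α τ` is finite for `τ` near `τ₀`
  set a : ℝ → ℂ := fun τ => (α τ).elim z₀ id with hadef
  have ha : ∀ τ z, α τ = ((z : ℂ) : OnePoint ℂ) → a τ = z := by
    intro τ z h
    simp [hadef, h]
  have hexp : ∀ φ₁ φ₂ : ℝ, φ₁ ∈ Set.Icc 0 Real.pi → φ₂ ∈ Set.Icc 0 Real.pi →
      Complex.exp ((((f z₀).arg + n * φ₁ : ℝ) : ℂ) * Complex.I) = (1 : ℝ) →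
      Complex.exp ((((f z₀).arg + n * φ₂ : ℝ) : ℂ) * Complex.I) = (-1 : ℝ) →
      (0 < Real.sin φ₁ ∨ (Real.sin φ₁ = 0 ∧ 1 * Real.cos φ₁ < 0)) →
      (0 < Real.sin φ₂ ∨ (Real.sin φ₂ = 0 ∧ -1 * Real.cos φ₂ < 0)) →
      ∃ ε > 0, (∀ τ ∈ Set.Ioo (τ₀ - ε) (τ₀ + ε), α τ = (a τ : OnePoint ℂ)) ∧
        (∀ τ ∈ Set.Ioo (τ₀ - ε) (τ₀ + ε), τ ≠ τ₀ → a τ ≠ (z₀ : ℂ)) ∧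
        Tendsto a (𝓝 τ₀) (𝓝 (z₀ : ℂ)) ∧
        (n = 1 → AnalyticOnNhd ℝ a (Set.Ioo (τ₀ - ε) (τ₀ + ε))) ∧
        AnalyticOnNhd ℝ a (Set.Ioo (τ₀ - ε) τ₀) ∧
        AnalyticOnNhd ℝ a (Set.Ioo τ₀ (τ₀ + ε)) ∧
        Tendsto (fun τ => (a τ - z₀).arg) (𝓝[>] τ₀) (𝓝 φ₁) ∧
        Tendsto (fun τ => (a τ - z₀).arg) (𝓝[<] τ₀) (𝓝 φ₂) := by
    intro φ₁ φ₂ hφ₁ hφ₂ he₁ he₂ hd₁ hd₂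
    obtain ⟨ω₁, hω₁, hcω₁, harg₁, hdir₁⟩ := exists_mul_pow_eq_of_arg hf0 hn hφ₁ he₁ hd₁
    obtain ⟨ω₂, hω₂, hcω₂, harg₂, hdir₂⟩ := exists_mul_pow_eq_of_arg hf0 hn hφ₂ he₂ hd₂
    have := exists_two_sided_expansion (fun τ => (hα τ).1) ha hz₀ hn hψa hψ0 hψd hf0 hω₁ hω₂
      hcω₁ hcω₂
      (eventually_eq_branch hloc hΩ hQt hnc hz₀Ω hz₀ hn hf hQf hψa hψ0 hψd hψ hcω₁ hdir₁)
      (eventually_eq_branch hloc hΩ hQt hnc hz₀Ω hz₀ hn hf hQf hψa hψ0 hψd hψ hcω₂ hdir₂)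
    rwa [harg₁, harg₂] at this
  have hder : ∀ {j : ℕ}, 0 < j → (j < n → iteratedDeriv j Qt z₀ = 0) ∧
      (j = n → iteratedDeriv j Qt z₀ = n.factorial * f z₀) := fun hj =>
    iteratedDeriv_of_eventuallyEq_const_add hf hQf hj
  have hpi := Real.pi_pos
  have hexp_pi : ∀ x : ℝ, x = Real.pi → Complex.exp ((x : ℂ) * Complex.I) = (-1 : ℝ) := by
    rintro x rfl
    rw [Complex.exp_pi_mul_I]; simp
  have hexp_two_pi : ∀ x : ℝ, x = 2 * Real.pi →
      Complex.exp ((x : ℂ) * Complex.I) = (1 : ℝ) := by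
    rintro x rfl
    push_cast
    rw [Complex.exp_two_pi_mul_I]
  rcases hcases with ⟨rfl, him, hre⟩ | ⟨rfl, him⟩ | ⟨rfl, him, hre⟩
  -- `n = 1`, `f z₀ < 0`: the equations `f z₀ * ω = 1` and `f z₀ * ω = -1` have the solutions with
  -- arguments `π` and `0`
  · have harg : (f z₀).arg = Real.pi := Complex.arg_eq_pi_iff.2 ⟨hre, him⟩
    obtain ⟨ε, hε, h1, h2, h3, h4, -, -, h5, h6⟩ := hexp Real.pi 0 ⟨hpi.le, le_rfl⟩
      ⟨le_rfl, hpi.le⟩ (hexp_two_pi _ (by rw [harg]; push_cast; ring))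
      (hexp_pi _ (by rw [harg]; push_cast; ring)) (by simp) (by simp)
    have hd : deriv Qt z₀ = f z₀ := by
      have := (hder one_pos).2 rfl
      simpa using this
    exact ⟨ε, a, hε, h1, h2, h3, Or.inl ⟨by rw [hd]; exact ⟨him, hre⟩, h4 rfl, h6, h5⟩⟩
  -- `n = 2`: of the two square roots `ω` on each side, the one in the closed upper half-plane and,
  -- among real ones, the one along which `Qt' < 0`
  · have hd1 : deriv Qt z₀ = 0 := by
      have := (hder one_pos).1 (by norm_num)
      simpa using this
    have hd2 : iteratedDeriv 2 Qt z₀ = ((2 : ℝ) : ℂ) * f z₀ := by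
      have := (hder two_pos).2 rfl
      simpa using this
    have harg : (iteratedDeriv 2 Qt z₀).arg = (f z₀).arg := by
      rw [hd2, Complex.arg_real_mul _ two_pos]
    have h0 : 0 ≤ (f z₀).arg := Complex.arg_nonneg_iff.2 him
    have hle : (f z₀).arg ≤ Real.pi := Complex.arg_le_pi _
    set θ := (f z₀).arg with hθ
    obtain ⟨ε, hε, h1, h2, h3, -, h4, h4', h5, h6⟩ := hexp ((2 * Real.pi - θ) / 2)
      ((Real.pi - θ) / 2) ⟨by linarith, by linarith⟩ ⟨by linarith, by linarith⟩
      (hexp_two_pi _ (by push_cast; ring)) (hexp_pi _ (by push_cast; ring))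
      (by
        rcases h0.eq_or_lt with h | h
        · right; rw [← h]; simp
        · left; exact Real.sin_pos_of_pos_of_lt_pi (by linarith) (by linarith))
      (by
        rcases hle.eq_or_lt with h | h
        · right; rw [h]; simp
        · left; exact Real.sin_pos_of_pos_of_lt_pi (by linarith) (by linarith))
    refine ⟨ε, a, hε, h1, h2, h3, Or.inr (Or.inl ⟨⟨hd1, ?_⟩, ?_, h4, h4', ?_, ?_⟩)⟩
    · rw [hd2]; exact mul_ne_zero (by norm_num) hf0
    · rw [hd2, Complex.im_ofReal_mul]; exact mul_nonneg zero_le_two him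
    · rw [harg]; exact h5
    · rw [harg]; exact h6
  -- `n = 3`, `f z₀ > 0`: one of the three cube roots `ω` lies in the open upper half-plane
  · have harg : (f z₀).arg = 0 := Complex.arg_eq_zero_iff.2 ⟨hre.le, him⟩
    have hd1 : deriv Qt z₀ = 0 := by
      have := (hder one_pos).1 (by norm_num)
      simpa using this
    have hd2 : iteratedDeriv 2 Qt z₀ = 0 := (hder two_pos).1 (by norm_num)
    have hd3 : iteratedDeriv 3 Qt z₀ ≠ 0 := by
      rw [(hder three_pos).2 rfl]
      exact mul_ne_zero (by exact_mod_cast Nat.factorial_ne_zero 3) hf0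
    obtain ⟨ε, hε, h1, h2, h3, -, h4, h4', h5, h6⟩ := hexp (2 * Real.pi / 3) (Real.pi / 3)
      ⟨by linarith, by linarith⟩ ⟨by linarith, by linarith⟩
      (hexp_two_pi _ (by rw [harg]; push_cast; ring)) (hexp_pi _ (by rw [harg]; push_cast; ring))
      (Or.inl (Real.sin_pos_of_pos_of_lt_pi (by linarith) (by linarith)))
      (Or.inl (Real.sin_pos_of_pos_of_lt_pi (by linarith) (by linarith)))
    exact ⟨ε, a, hε, h1, h2, h3, Or.inr (Or.inr ⟨⟨hd1, hd2, hd3⟩, h4, h4', h6, h5⟩)⟩
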